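/- **Setting.** Let $m\ge 0$, $N\ge 1$, let $\mathcal H_c=\mathbb C^{2^m}$ with basis $|0\rangle,\dots,|2^m-1\rangle$ be the state space of the quantum variable $q_1$, and $\mathcal H_s=\mathbb C^N$ that of $q_2$. Let $|s\rangle,|t\rangle\in\mathcal H_s$ be unit vectors, $V$ any unitary on $\mathcal H_s$, $R_x=I-(1-e^{i\pi/3})|x\rangle\langle x|$ for $x\in\{s,t\}$, and $$V_0=V,\qquad V_{n+1}=V_nR_sV_n^\dagger R_tV_n .$$ Let $U_{\pm1}|x\rangle=|x\pm1 \bmod 2^m\rangle$ on $\mathcal H_c$ and $M=\{M_0=|0\rangle\langle0|,\ M_1=\sum_{i\ge1}|i\rangle\langle i|\}$. The mutually recursive procedures are - $\mathrm{qSearch}$: measure $M$ on $q_1$; on outcome 0 run $q_2:=V q_2$; on outcome 1 run $q_1:=U_{-1}q_1$; call qSearch; $q_2:=R_tq_2$; call qSearch†; $q_2:=R_sq_2$; call qSearch; $q_1:=U_{+1}q_1$; - $\mathrm{qSearch}^\dagger$: measure $M$ on $q_1$; on outcome 0 run $q_2:=V^\dagger q_2$; on outcome 1 run $q_1:=U_{-1}q_1$;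 call qSearch†; $q_2:=R_s^\dagger q_2$; call qSearch; $q_2:=R_t^\dagger q_2$; call qSearch†; $q_1:=U_{+1}q_1$. **Semantics.** Statements are built from $\bot$, skip, initialization, unitaries, sequencing, measurement branching and calls. They denote quantum operations on $\mathcal H_c\otimes\mathcal H_s$; a call denotes the limit of the denotations of the syntactic approximations $S_p^{(0)}=\bot$, $S_p^{(k+1)}=S_p[\,\mathrm{skip};S_{p'}^{(k)}/\mathrm{call}\ p'\,]$ of the procedure bodies $S_p$. The weakest precondition $\mathrm{wp}$ and weakest liberal precondition $\mathrm{wlp}$ are given by the dual recursion, with value $0$, respectively $I$, at $\bot$, a call again being the limit over its approximations. Assertions are terms $\mathcal E^*(\mathcal B)+\mathcal F^*(I)$, where $\mathcal E,\mathcal F$ are quantum operations with $(\mathcal E+\mathcal F)^*(I)\sqsubseteq I$ and $\mathcal B$ is a tensor product over disjoint lists of variables of quantum predicate variables (ranging over operators between $0$ and $I$) and identities. $P\sqsubseteq Q$ means that $P,Q$ have the same predicate variables and the Löwner order holds under all assignments. $\models\langle P\rangle S\langle Q\rangle$ (total) means $P\sqsubseteq \mathrm{wp}.S.Q$, and $\models\{P\}S\{Q\}$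 (partial) means $P\sqsubseteq\mathrm{wlp}.S.Q$. **Proof systems.** The base system has the axioms for $\bot$ (precondition $0$ for total, $I$ for partial correctness), skip, initialization and unitaries, and the rules of composition, measurement branching ($\{P_k\}S_k\{Q\}$ for all $k$ gives precondition $\sum_kM_k^\dagger P_kM_k$), order (with all valid $P\sqsubseteq Q$ as axioms) and substitution of terms for predicate variables. For total correctness add the rule (Rt gRec): if for each procedure $p$ there is an increasing sequence $P_p^j=\mathcal E_{p,j}^*(R_p)$, with $\mathcal E_{p,j}\sqsubseteq\mathcal E_{p,j+1}$ quantum operations and $R_p$ a term, with $P^0_p=0$ and $P_p\sqsubseteq\bigsqcup_jP_p^j$, such that for every $j$ the base system proves $\langle P^{j+1}_p\rangle S_p\langle Q_p\rangle$ for all $p$ from the hypotheses $\{\langle P^j_{p'}\rangle\,\mathrm{call}\ p'\,\langle Q_{p'}\rangle\}_{p'}$, then $\langle P_p\rangle\,\mathrm{call}\ p\,\langle Q_p\rangle$ for all $p$. For partial correctness add (Rp gRec): if the base system proves $\{P_p\}S_p\{Q_p\}$ for all $p$ from $\{\{P_{p'}\}\,\mathrm{call}\ p'\,\{Q_{p'}\}\}_{p'}$,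 then $\{P_p\}\,\mathrm{call}\ p\,\{Q_p\}$ for all $p$. Write $\vdash$ for provability in the extended systems. **Theorem.** Put $W_n=V_n$ for $p=\mathrm{qSearch}$ and $W_n=V_n^\dagger$ for $p=\mathrm{qSearch}^\dagger$. 1. For both $p$ and all $0\le n<2^m$, the triple $$\langle\,|n\rangle\langle n|\otimes|s\rangle\langle s|\,\rangle\ \mathrm{call}\ p\ \langle\,|n\rangle\langle n|\otimes W_n|s\rangle\langle s|W_n^\dagger\,\rangle$$ is both valid ($\models$) and provable ($\vdash$) in the total-correctness logic, and the same triple is valid and provable in the partial-correctness logic. Moreover $\mathrm{call}\ p$ maps the state $|n\rangle\langle n|\otimes|s\rangle\langle s|$ to $|n\rangle\langle n|\otimes W_n|s\rangle\langle s|W_n^\dagger$. In particular, for $p=\mathrm{qSearch}$, $\langle|n\rangle\langle n|\otimes|s\rangle\langle s|\rangle\ \mathrm{call}\ \mathrm{qSearch}\ \langle|n\rangle\langle n|\otimes V_n|s\rangle\langle s|V_n^\dagger\rangle$. 2. With predicate variables $A$ on $q_1$ and $B$ on $q_2$, for both $p$ the triple with precondition $\sum_{i<2^m}A_{i,i}|i\rangle\langle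 i|\otimes B$, statement $\mathrm{call}\ p$ and postcondition $\sum_{i<2^m}A_{i,i}|i\rangle\langle i|\otimes W_iBW_i^\dagger$ is valid and provable in both logics. 3. With a predicate variable $X$ on $(q_1,q_2)$, put $$P_j[X]=\sum_{i<\min(j,2^m)}(|i\rangle\langle i|\otimes I)X(|i\rangle\langle i|\otimes I),\qquad Q_p[X]=\sum_{i<2^m}(|i\rangle\langle i|\otimes W_i)X(|i\rangle\langle i|\otimes W_i^\dagger).$$ (For $X=A\otimes B$, $P_j$ is $\sum_{i<\min(j,2^m)}A_{i,i}|i\rangle\langle i|\otimes B$.) The increasing sequence $P_j[X]$ (the same for both procedures) satisfies all premises of (Rt gRec) for the preconditions $P_{2^m}[X]$ and the postconditions $Q_p[X]$; and $P_{2^m}[X]$, $Q_p[X]$ satisfy the premise of (Rp gRec). -/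

import Mathlib

open scoped Kronecker ComplexOrder

noncomputable section

namespace QHoare

/-! ### Operators, predicates and quantum operations -/

/-- The Löwner order: `B - A` is positive. -/
def Loewner {σ : Type} (A B : Matrix σ σ ℂ) : Prop := (B - A).PosSemidef

/-- Quantum predicates: `0 ⊑ A ⊑ I`. -/
def IsQPred {σ : Type} [DecidableEq σ] (A : Matrix σ σ ℂ) : Prop :=
  Loewner 0 A ∧ Loewner A 1

/-- The outer product `|ψ⟩⟨φ|`. -/
def outer {σ : Type} (ψ φ : σ → ℂ) : Matrix σ σ ℂ := Matrix.vecMulVec ψ (star φ)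

/-- The upper (lower) limit of an increasing (decreasing) sequence of operators. -/
def limit {σ : Type} (A : ℕ → Matrix σ σ ℂ) : Matrix σ σ ℂ := Filter.limUnder Filter.atTop A

/-- A quantum operation `∑ₖ Kₖ ⋄ Kₖ†` on the space with computational basis `σ`
(completely positive and trace-non-increasing), given by Kraus operators. -/
structure QOp (σ : Type) [Fintype σ] [DecidableEq σ] where
  size : ℕ
  kraus : Fin size → Matrix σ σ ℂ
  bound : Loewner (∑ k, (kraus k).conjTranspose * kraus k) 1

/-- `ℰ(ρ)`. -/
def QOp.app {σ : Type} [Fintype σ] [DecidableEq σ] (E : QOp σ) (ρ : Matrix σ σ ℂ) :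
    Matrix σ σ ℂ :=
  ∑ k, E.kraus k * ρ * (E.kraus k).conjTranspose

/-- The Schrödinger–Heisenberg dual `ℰ*(A)`. -/
def QOp.dual {σ : Type} [Fintype σ] [DecidableEq σ] (E : QOp σ) (A : Matrix σ σ ℂ) :
    Matrix σ σ ℂ :=
  ∑ k, (E.kraus k).conjTranspose * A * E.kraus k

/-- The order on quantum operations: `ℰ + 𝒢 = ℱ` for some quantum operation `𝒢`. -/
def QOp.le {σ : Type} [Fintype σ] [DecidableEq σ] (E F : QOp σ) : Prop :=
  ∃ G : QOp σ, ∀ ρ, F.app ρ = E.app ρ + G.app ρ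

/-- The quantum operation `0 ⋄ 0`. -/
def QOp.zero (σ : Type) [Fintype σ] [DecidableEq σ] : QOp σ where
  size := 0
  kraus := fun _ => 0
  bound := by simpa [Loewner] using Matrix.PosSemidef.one

/-- A quantum measurement with outcomes `0, …, k - 1`. -/
structure Meas (σ : Type) [Fintype σ] [DecidableEq σ] (k : ℕ) where
  op : Fin k → Matrix σ σ ℂ
  complete : ∑ i, (op i).conjTranspose * op i = 1

/-! ### Recursive quantum programs over two quantum variables `q₁`, `q₂` -/

/-- Something attached to the variable list `q₁`, `q₂` or `q₁, q₂`. -/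
inductive OnReg (α β γ : Type) : Type
  | q₁ (a : α)
  | q₂ (b : β)
  | q₁q₂ (c : γ)

/-- The two quantum variables. -/
inductive Var : Type
  | q₁
  | q₂

/-- Computational basis of the joint state space of `q₁` (dimension `d₁`) and `q₂`
(dimension `d₂`). -/
abbrev Joint (d₁ d₂ : ℕ) : Type := Fin d₁ × Fin d₂

/-- Operators on the joint state space. -/
abbrev Op (d₁ d₂ : ℕ) : Type := Matrix (Joint d₁ d₂) (Joint d₁ d₂) ℂ

/-- An operator on part of the variables acts as the identity on the rest. -/
def lift {d₁ d₂ : ℕ} :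
    OnReg (Matrix (Fin d₁) (Fin d₁) ℂ) (Matrix (Fin d₂) (Fin d₂) ℂ) (Op d₁ d₂) → Op d₁ d₂
  | .q₁ A => A ⊗ₖ 1
  | .q₂ B => 1 ⊗ₖ B
  | .q₁q₂ C => C

/-- Unitary operators on `q₁`, `q₂` or `q₁, q₂`. -/
abbrev LocalUnitary (d₁ d₂ : ℕ) : Type :=
  OnReg (Matrix.unitaryGroup (Fin d₁) ℂ) (Matrix.unitaryGroup (Fin d₂) ℂ)
    (Matrix.unitaryGroup (Joint d₁ d₂) ℂ)

/-- Measurements of `q₁`, `q₂` or `q₁, q₂`. -/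
abbrev LocalMeas (d₁ d₂ k : ℕ) : Type :=
  OnReg (Meas (Fin d₁) k) (Meas (Fin d₂) k) (Meas (Joint d₁ d₂) k)

def LocalUnitary.toOp {d₁ d₂ : ℕ} : LocalUnitary d₁ d₂ → Op d₁ d₂
  | .q₁ U => lift (.q₁ U.1)
  | .q₂ U => lift (.q₂ U.1)
  | .q₁q₂ U => lift (.q₁q₂ U.1)

def LocalMeas.toOp {d₁ d₂ k : ℕ} : LocalMeas d₁ d₂ k → Fin k → Op d₁ d₂
  | .q₁ M => fun i => lift (.q₁ (M.op i))
  | .q₂ M => fun i => lift (.q₂ (M.op i))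
  | .q₁q₂ M => fun i => lift (.q₁q₂ (M.op i))

/-- Statements, with procedure names in `Name`. -/
inductive Stmt (d₁ d₂ : ℕ) (Name : Type) : Type
  | bot
  | skip
  | init (q : Var)
  | unitary (U : LocalUnitary d₁ d₂)
  | seq (S T : Stmt d₁ d₂ Name)
  | branch {k : ℕ} (M : LocalMeas d₁ d₂ k) (S : Fin k → Stmt d₁ d₂ Name)
  | call (p : Name)

/-- Procedure declarations: every name is given a body. -/
abbrev Decl (d₁ d₂ : ℕ) (Name : Type) : Type := Name → Stmt d₁ d₂ Name

/-- Simultaneous substitution of `T p` for `call p`. -/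
def Stmt.replace {d₁ d₂ : ℕ} {Name : Type} (T : Name → Stmt d₁ d₂ Name) :
    Stmt d₁ d₂ Name → Stmt d₁ d₂ Name
  | .bot => .bot
  | .skip => .skip
  | .init q => .init q
  | .unitary U => .unitary U
  | .seq S₁ S₂ => .seq (S₁.replace T) (S₂.replace T)
  | .branch M S => .branch M (fun i => (S i).replace T)
  | .call p => T p

/-- The syntactic approximations of the procedure bodies. -/
def approx {d₁ d₂ : ℕ} {Name : Type} (D : Decl d₁ d₂ Name) : ℕ → Name → Stmt d₁ d₂ Name
  | 0, _ => .bot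
  | k + 1, p => (D p).replace (fun p' => .seq .skip (approx D k p'))

/-- The Kraus operators `|0⟩⟨i|` of the initialization of one variable. -/
def initOp (d₁ d₂ : ℕ) [NeZero d₁] [NeZero d₂] : (q : Var) →
    (match q with | .q₁ => Fin d₁ | .q₂ => Fin d₂) → Op d₁ d₂
  | .q₁, i => lift (.q₁ (Matrix.single 0 i 1))
  | .q₂, i => lift (.q₂ (Matrix.single 0 i 1))

/-- The denotation of `q := |0⟩` as an operation on states. -/
def initSem {d₁ d₂ : ℕ} [NeZero d₁] [NeZero d₂] (q : Var) (ρ : Op d₁ d₂) : Op d₁ d₂ :=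
  match q with
  | .q₁ => ∑ i, initOp d₁ d₂ .q₁ i * ρ * (initOp d₁ d₂ .q₁ i).conjTranspose
  | .q₂ => ∑ i, initOp d₁ d₂ .q₂ i * ρ * (initOp d₁ d₂ .q₂ i).conjTranspose

/-- The dual of the denotation of `q := |0⟩`. -/
def initPre {d₁ d₂ : ℕ} [NeZero d₁] [NeZero d₂] (q : Var) (A : Op d₁ d₂) : Op d₁ d₂ :=
  match q with
  | .q₁ => ∑ i, (initOp d₁ d₂ .q₁ i).conjTranspose * A * initOp d₁ d₂ .q₁ i
  | .q₂ => ∑ i, (initOp d₁ d₂ .q₂ i).conjTranspose * A * initOp d₁ d₂ .q₂ i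

/-- The denotation of a statement, with `ω p` as the denotation of `call p`. -/
def semWith {d₁ d₂ : ℕ} [NeZero d₁] [NeZero d₂] {Name : Type} (ω : Name → Op d₁ d₂ → Op d₁ d₂) :
    Stmt d₁ d₂ Name → Op d₁ d₂ → Op d₁ d₂
  | .bot, _ => 0
  | .skip, ρ => ρ
  | .init q, ρ => initSem q ρ
  | .unitary U, ρ => U.toOp * ρ * U.toOp.conjTranspose
  | .seq S T, ρ => semWith ω T (semWith ω S ρ)
  | .branch M S, ρ => ∑ i, semWith ω (S i) (M.toOp i * ρ * (M.toOp i).conjTranspose)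
  | .call p, ρ => ω p ρ

/-- The denotational semantics: a call denotes the limit of its syntactic approximations
(which contain no calls, so that the interpretation of calls in them does not matter). -/
def sem {d₁ d₂ : ℕ} [NeZero d₁] [NeZero d₂] {Name : Type} (D : Decl d₁ d₂ Name) :
    Stmt d₁ d₂ Name → Op d₁ d₂ → Op d₁ d₂ :=
  semWith (fun p ρ => limit (fun n => semWith (fun _ _ => 0) (approx D n p) ρ))

/-- Partial or total correctness. -/
inductive Mode : Type
  | part
  | total

/-- The weakest (liberal) precondition of `⊥`: `I` for partial, `0` for total correctness. -/
def Mode.botPre {d₁ d₂ : ℕ} : Mode → Op d₁ d₂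
  | .part => 1
  | .total => 0

/-- Weakest (liberal) preconditions, with `ω p` as the transformer of `call p`. -/
def preWith {d₁ d₂ : ℕ} [NeZero d₁] [NeZero d₂] {Name : Type} (c : Mode)
    (ω : Name → Op d₁ d₂ → Op d₁ d₂) : Stmt d₁ d₂ Name → Op d₁ d₂ → Op d₁ d₂
  | .bot, _ => c.botPre
  | .skip, A => A
  | .init q, A => initPre q A
  | .unitary U, A => U.toOp.conjTranspose * A * U.toOp
  | .seq S T, A => preWith c ω S (preWith c ω T A)
  | .branch M S, A => ∑ i, (M.toOp i).conjTranspose * preWith c ω (S i) A * M.toOp i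
  | .call p, A => ω p A

/-- The weakest precondition (total mode) and the weakest liberal precondition (partial mode);
the one of a call is the limit of those of its syntactic approximations. -/
def weakestPre {d₁ d₂ : ℕ} [NeZero d₁] [NeZero d₂] {Name : Type} (c : Mode)
    (D : Decl d₁ d₂ Name) : Stmt d₁ d₂ Name → Op d₁ d₂ → Op d₁ d₂ :=
  preWith c (fun p A => limit (fun n => preWith c (fun _ _ => 0) (approx D n p) A))

/-! ### Parameterized quantum predicate terms -/

/-- An assignment of operators to the predicate variables on `q₁`, on `q₂` and on `q₁, q₂`
(each kind is numbered by `ℕ`). -/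
structure Assignment (d₁ d₂ : ℕ) where
  v₁ : ℕ → Matrix (Fin d₁) (Fin d₁) ℂ
  v₂ : ℕ → Matrix (Fin d₂) (Fin d₂) ℂ
  v₁₂ : ℕ → Op d₁ d₂

/-- Predicate variables range over quantum predicates. -/
def Assignment.Valid {d₁ d₂ : ℕ} (v : Assignment d₁ d₂) : Prop :=
  (∀ x, IsQPred (v.v₁ x)) ∧ (∀ x, IsQPred (v.v₂ x)) ∧ ∀ x, IsQPred (v.v₁₂ x)

/-- Bases on `q₁, q₂`: a variable on the pair, or a tensor product whose factors are a
variable (`some x`) or the identity (`none`). -/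
inductive Base : Type
  | var (x : ℕ)
  | tensor (a b : Option ℕ)

/-- Predicate variables. -/
abbrev PVar : Type := OnReg ℕ ℕ ℕ

/-- A parameterized quantum predicate term `ℰ*(ℬ) + ℱ*(I)` with base `ℬ` in `β`, where
`ℰ + ℱ` is trace-non-increasing. -/
structure Term (β σ : Type) [Fintype σ] [DecidableEq σ] where
  base : β
  E : QOp σ
  F : QOp σ
  bound : Loewner (E.dual 1 + F.dual 1) 1

/-- Terms on `q₁, q₂`. -/
abbrev Assertion (d₁ d₂ : ℕ) : Type := Term Base (Joint d₁ d₂)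

/-- Terms on a single variable; the base is a predicate variable or the identity. -/
abbrev Term₁ (d : ℕ) : Type := Term (Option ℕ) (Fin d)

def Term.denWith {β σ : Type} [Fintype σ] [DecidableEq σ] (P : Term β σ)
    (B : β → Matrix σ σ ℂ) : Matrix σ σ ℂ :=
  P.E.dual (B P.base) + P.F.dual 1

/-- Denotation of a base on a single variable. -/
def den₁ {σ : Type} [DecidableEq σ] (v : ℕ → Matrix σ σ ℂ) : Option ℕ → Matrix σ σ ℂ
  | none => 1
  | some x => v x

def Base.den {d₁ d₂ : ℕ} (v : Assignment d₁ d₂) : Base → Op d₁ d₂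
  | .var x => v.v₁₂ x
  | .tensor a b => den₁ v.v₁ a ⊗ₖ den₁ v.v₂ b

/-- The denotation of an assertion under an assignment. -/
def den {d₁ d₂ : ℕ} (P : Assertion d₁ d₂) (v : Assignment d₁ d₂) : Op d₁ d₂ :=
  P.denWith (Base.den v)

def Base.params : Base → Set PVar
  | .var x => {.q₁q₂ x}
  | .tensor a b => {X | (∃ x, a = some x ∧ X = .q₁ x) ∨ (∃ y, b = some y ∧ X = .q₂ y)}

/-- The parameters of an assertion. -/
def params {d₁ d₂ : ℕ} (P : Assertion d₁ d₂) : Set PVar := P.base.params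

/-- The valid order formulas `P ⊑ Q`. -/
def Below {d₁ d₂ : ℕ} (P Q : Assertion d₁ d₂) : Prop :=
  params P = params Q ∧ ∀ v : Assignment d₁ d₂, v.Valid → Loewner (den P v) (den Q v)

/-- `P` has the parameters of `Q`, and its denotation is the transform by `f` of that of `Q`. -/
def Denotes {d₁ d₂ : ℕ} (P : Assertion d₁ d₂) (f : Op d₁ d₂ → Op d₁ d₂)
    (Q : Assertion d₁ d₂) : Prop :=
  params P = params Q ∧ ∀ v : Assignment d₁ d₂, v.Valid → den P v = f (den Q v)

/-- Simultaneous substitutions of terms for predicate variables. -/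
structure Substitution (d₁ d₂ : ℕ) where
  t₁ : ℕ → Term₁ d₁
  t₂ : ℕ → Term₁ d₂
  t₁₂ : ℕ → Assertion d₁ d₂

def Substitution.act {d₁ d₂ : ℕ} (θ : Substitution d₁ d₂) (v : Assignment d₁ d₂) :
    Assignment d₁ d₂ where
  v₁ x := (θ.t₁ x).denWith (den₁ v.v₁)
  v₂ x := (θ.t₂ x).denWith (den₁ v.v₂)
  v₁₂ x := den (θ.t₁₂ x) v

/-- The parameters of the term that replaces a predicate variable. -/
def Substitution.params {d₁ d₂ : ℕ} (θ : Substitution d₁ d₂) : PVar → Set PVar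
  | .q₁ x => {X | ∃ y, (θ.t₁ x).base = some y ∧ X = .q₁ y}
  | .q₂ x => {X | ∃ y, (θ.t₂ x).base = some y ∧ X = .q₂ y}
  | .q₁q₂ x => QHoare.params (θ.t₁₂ x)

/-- The term that replaces a predicate variable has no summand `ℱ*(I)`. -/
def Substitution.Pure {d₁ d₂ : ℕ} (θ : Substitution d₁ d₂) : PVar → Prop
  | .q₁ x => (θ.t₁ x).F.dual 1 = 0
  | .q₂ x => (θ.t₂ x).F.dual 1 = 0
  | .q₁q₂ x => (θ.t₁₂ x).F.dual 1 = 0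

/-- Substitution into `P` is allowed: if `P` has two parameters, then each of them is replaced by
a term `ℰ*(ℬ)` or by a term without parameters. -/
def Substitution.Allowed {d₁ d₂ : ℕ} (θ : Substitution d₁ d₂) (P : Assertion d₁ d₂) : Prop :=
  (QHoare.params P).Subsingleton ∨ ∀ X ∈ QHoare.params P, θ.Pure X ∨ θ.params X = ∅

/-- The assertion `P'` is `P[θ]`. -/
def IsSubst {d₁ d₂ : ℕ} (θ : Substitution d₁ d₂) (P P' : Assertion d₁ d₂) : Prop :=
  θ.Allowed P ∧ params P' = {Y | ∃ X ∈ params P, Y ∈ θ.params X} ∧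
    ∀ v : Assignment d₁ d₂, v.Valid → den P' v = den P (θ.act v)

/-! ### Correctness and proof systems -/

/-- A Hoare triple. -/
structure Triple (d₁ d₂ : ℕ) (Name : Type) where
  pre : Assertion d₁ d₂
  stmt : Stmt d₁ d₂ Name
  post : Assertion d₁ d₂

/-- Correctness: equal parameters, and `pre ⊑ fwp.stmt.post` (resp. `fwlp`) under all
assignments. -/
def Correct {d₁ d₂ : ℕ} [NeZero d₁] [NeZero d₂] {Name : Type} (c : Mode) (D : Decl d₁ d₂ Name)
    (T : Triple d₁ d₂ Name) : Prop :=
  params T.pre = params T.post ∧ ∀ v : Assignment d₁ d₂, v.Valid →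
    Loewner (den T.pre v) (weakestPre c D T.stmt (den T.post v))

/-- The base proof system for partial (total) correctness, from hypotheses `Γ` and all valid order
formulas. Terms are written up to valid equality, which the order rule makes harmless. -/
inductive BaseProvable {d₁ d₂ : ℕ} [NeZero d₁] [NeZero d₂] {Name : Type} (c : Mode)
    (Γ : Set (Triple d₁ d₂ Name)) : Triple d₁ d₂ Name → Prop
  | hyp (T : Triple d₁ d₂ Name) : T ∈ Γ → BaseProvable c Γ T
  | bot (P Q : Assertion d₁ d₂) : Denotes P (fun _ => c.botPre) Q →
      BaseProvable c Γ ⟨P, .bot, Q⟩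
  | skip (P : Assertion d₁ d₂) : BaseProvable c Γ ⟨P, .skip, P⟩
  | init (q : Var) (P Q : Assertion d₁ d₂) : Denotes P (initPre q) Q →
      BaseProvable c Γ ⟨P, .init q, Q⟩
  | unitary (U : LocalUnitary d₁ d₂) (P Q : Assertion d₁ d₂) :
      Denotes P (fun A => U.toOp.conjTranspose * A * U.toOp) Q →
      BaseProvable c Γ ⟨P, .unitary U, Q⟩
  | comp (S₁ S₂ : Stmt d₁ d₂ Name) (P Q R : Assertion d₁ d₂) :
      BaseProvable c Γ ⟨P, S₁, Q⟩ → BaseProvable c Γ ⟨Q, S₂, R⟩ →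
      BaseProvable c Γ ⟨P, .seq S₁ S₂, R⟩
  | branch {k : ℕ} (M : LocalMeas d₁ d₂ k) (S : Fin k → Stmt d₁ d₂ Name)
      (P : Fin k → Assertion d₁ d₂) (R Q : Assertion d₁ d₂) :
      (∀ i, BaseProvable c Γ ⟨P i, S i, Q⟩) →
      (∀ i, params R = params (P i)) →
      (∀ v : Assignment d₁ d₂, v.Valid →
        den R v = ∑ i, (M.toOp i).conjTranspose * den (P i) v * M.toOp i) →
      BaseProvable c Γ ⟨R, .branch M S, Q⟩
  | order (S : Stmt d₁ d₂ Name) (P P' Q Q' : Assertion d₁ d₂) :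
      Below P P' → BaseProvable c Γ ⟨P', S, Q'⟩ → Below Q' Q → BaseProvable c Γ ⟨P, S, Q⟩
  | subst (θ : Substitution d₁ d₂) (S : Stmt d₁ d₂ Name) (P P' Q Q' : Assertion d₁ d₂) :
      BaseProvable c Γ ⟨P, S, Q⟩ → IsSubst θ P P' → IsSubst θ Q Q' →
      BaseProvable c Γ ⟨P', S, Q'⟩

/-- The triples `{P p} call p {Q p}`. -/
def callTriples {d₁ d₂ : ℕ} {Name : Type} (P Q : Name → Assertion d₁ d₂) :
    Set (Triple d₁ d₂ Name) :=
  {T | ∃ p, T = ⟨P p, .call p, Q p⟩}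

/-- Increasing sequences `Pₙ = ℰₙ*(R)` of assertions, with `ℰₙ ⊑ ℰₙ₊₁`. -/
def Increasing {d₁ d₂ : ℕ} (P : ℕ → Assertion d₁ d₂) : Prop :=
  ∃ (R : Assertion d₁ d₂) (E : ℕ → QOp (Joint d₁ d₂)),
    (∀ n, (E n).le (E (n + 1))) ∧ ∀ n, Denotes (P n) (E n).dual R

/-- The premise of the recursion rule for total correctness: from
`{Pʲ p} call p {Q p}` for all `p` the base system proves `{Pʲ⁺¹ p} D p {Q p}` for all `p`, where
`P⁰ p = 0` and `P p ⊑ ⨆ⱼ Pʲ p`. -/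
def TotalRecPremise {d₁ d₂ : ℕ} [NeZero d₁] [NeZero d₂] {Name : Type} (D : Decl d₁ d₂ Name)
    (Pseq : ℕ → Name → Assertion d₁ d₂) (P Q : Name → Assertion d₁ d₂) : Prop :=
  (∀ p, Increasing (fun j => Pseq j p)) ∧
  (∀ p, ∀ v : Assignment d₁ d₂, v.Valid → den (Pseq 0 p) v = 0) ∧
  (∀ j p, params (Pseq j p) = params (Q p)) ∧
  (∀ j p, BaseProvable .total (callTriples (Pseq j) Q) ⟨Pseq (j + 1) p, D p, Q p⟩) ∧
  (∀ p, params (P p) = params (Q p)) ∧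
  (∀ p, ∀ v : Assignment d₁ d₂, v.Valid →
    Loewner (den (P p) v) (limit (fun j => den (Pseq j p) v)))

/-- The premise of the recursion rule for partial correctness. -/
def PartialRecPremise {d₁ d₂ : ℕ} [NeZero d₁] [NeZero d₂] {Name : Type} (D : Decl d₁ d₂ Name)
    (P Q : Name → Assertion d₁ d₂) : Prop :=
  (∀ p, params (P p) = params (Q p)) ∧
  ∀ p, BaseProvable .part (callTriples P Q) ⟨P p, D p, Q p⟩

/-- The conclusions of the recursion rule. -/
def recConclusions {d₁ d₂ : ℕ} [NeZero d₁] [NeZero d₂] {Name : Type} (c : Mode)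
    (D : Decl d₁ d₂ Name) : Set (Triple d₁ d₂ Name) :=
  {T | ∃ P Q : Name → Assertion d₁ d₂, T ∈ callTriples P Q ∧
    match c with
    | .part => PartialRecPremise D P Q
    | .total => ∃ Pseq, TotalRecPremise D Pseq P Q}

/-- Provability in the base system extended by the recursion rule. The premises of that rule are
proofs in the base system only, so a proof in the extended system is a base proof from conclusions
of the recursion rule. -/
def Provable {d₁ d₂ : ℕ} [NeZero d₁] [NeZero d₂] {Name : Type} (c : Mode) (D : Decl d₁ d₂ Name)
    (T : Triple d₁ d₂ Name) : Prop :=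
  BaseProvable c (recConclusions c D) T

/-! ### Fixed-point search -/

/-- `R_ψ = I - (1 - exp(iπ/3)) |ψ⟩⟨ψ|`. -/
def phaseShiftOp {N : ℕ} (ψ : EuclideanSpace ℂ (Fin N)) : Matrix (Fin N) (Fin N) ℂ :=
  1 - (1 - Complex.exp (Complex.I * (Real.pi / 3))) • outer ψ ψ

theorem outer_mul_outer {N : ℕ} (ψ : EuclideanSpace ℂ (Fin N)) (h : ‖ψ‖ = 1) :
    outer ψ ψ * outer ψ ψ = outer (σ := Fin N) ψ ψ := by
  have h1 : (star (ψ : Fin N → ℂ)) ⬝ᵥ (ψ : Fin N → ℂ) = 1 := by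
    have h2 := EuclideanSpace.inner_eq_star_dotProduct ψ ψ
    rw [inner_self_eq_norm_sq_to_K, h] at h2
    rw [dotProduct_comm]
    simpa using h2.symm
  simp only [outer, Matrix.vecMulVec_mul_vecMulVec, h1]
  simp

theorem outer_conjTranspose {σ : Type} (ψ : σ → ℂ) :
    (outer ψ ψ).conjTranspose = outer ψ ψ := by
  simp [outer, Matrix.conjTranspose_vecMulVec]

theorem phaseShiftOp_mem {N : ℕ} (ψ : EuclideanSpace ℂ (Fin N)) (h : ‖ψ‖ = 1) :
    phaseShiftOp ψ ∈ Matrix.unitaryGroup (Fin N) ℂ := by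
  rw [Matrix.mem_unitaryGroup_iff, Matrix.star_eq_conjTranspose]
  have hp := outer_mul_outer ψ h
  have hc := outer_conjTranspose (ψ : Fin N → ℂ)
  set z := Complex.exp (Complex.I * (Real.pi / 3)) with hz
  have hzz : z * star z = 1 := by
    rw [hz, Complex.star_def, ← Complex.exp_conj, ← Complex.exp_add]
    simp [Complex.conj_ofNat]
  unfold phaseShiftOp
  rw [← hz]
  simp only [Matrix.conjTranspose_sub, Matrix.conjTranspose_smul, hc, Matrix.conjTranspose_one,
    mul_sub, sub_mul, mul_one, one_mul, smul_mul_assoc, mul_smul_comm, hp]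
  have : (1 - star (1 - z) * 1 - ((1 - z) - star (1 - z) * (1 - z)) : ℂ) = 1 := by
    simp only [star_sub, star_one]
    linear_combination hzz
  rw [← sub_eq_zero]
  have e : star (1 - z) + (1 - z) - star (1 - z) * (1 - z) = 0 := by linear_combination -this
  calc _ = (-(star (1 - z) + (1 - z) - star (1 - z) * (1 - z))) • outer (σ := Fin N) ψ ψ := by
        module
    _ = 0 := by rw [e]; simp

/-- The unitary `R_ψ` of a unit vector `ψ`. -/
def phaseShift {N : ℕ} (ψ : EuclideanSpace ℂ (Fin N)) (h : ‖ψ‖ = 1) :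
    Matrix.unitaryGroup (Fin N) ℂ :=
  ⟨phaseShiftOp ψ, phaseShiftOp_mem ψ h⟩

/-- The search engine `V₀ = V`, `Vₙ₊₁ = Vₙ R_s Vₙ† R_t Vₙ`. -/
def engine {N : ℕ} (V Rs Rt : Matrix.unitaryGroup (Fin N) ℂ) :
    ℕ → Matrix.unitaryGroup (Fin N) ℂ
  | 0 => V
  | n + 1 => engine V Rs Rt n * Rs * star (engine V Rs Rt n) * Rt * engine V Rs Rt n

/-- The permutation `|x⟩ ↦ |f x⟩` of the basis. -/
def permUnitary {d : ℕ} (f : Equiv.Perm (Fin d)) : Matrix.unitaryGroup (Fin d) ℂ :=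
  ⟨Matrix.of fun y x => if y = f x then 1 else 0, by
    rw [Matrix.mem_unitaryGroup_iff']
    ext i j
    simp [Matrix.mul_apply, Matrix.star_apply, Matrix.one_apply, eq_comm]⟩

/-- `U₊₁ : |x⟩ ↦ |x + 1 mod 2^m⟩` and `U₋₁ : |x⟩ ↦ |x - 1 mod 2^m⟩`. -/
def shiftUp (m : ℕ) : Matrix.unitaryGroup (Fin (2 ^ m)) ℂ := permUnitary (Equiv.addRight 1)

def shiftDown (m : ℕ) : Matrix.unitaryGroup (Fin (2 ^ m)) ℂ := permUnitary (Equiv.subRight 1)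

/-- The measurement `M₀ = |0⟩⟨0|`, `M₁ = ∑_{i ≥ 1} |i⟩⟨i|`. -/
def zeroTest (m : ℕ) : Meas (Fin (2 ^ m)) 2 where
  op := ![Matrix.diagonal fun i => if i = 0 then 1 else 0,
    Matrix.diagonal fun i => if i = 0 then 0 else 1]
  complete := by
    rw [Fin.sum_univ_two]
    ext i j
    by_cases h : i = j
    · subst h
      by_cases hi : i = 0 <;> simp [hi, Matrix.diagonal_conjTranspose]
    · simp [h, Matrix.diagonal_conjTranspose]

/-- The two procedure names. -/
inductive Proc : Type
  | qSearch
  | qSearchDag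

/-- The bodies of the two procedures. -/
def searchDecl (m : ℕ) {N : ℕ} (V Rs Rt : Matrix.unitaryGroup (Fin N) ℂ) :
    Decl (2 ^ m) N Proc
  | .qSearch => .branch (.q₁ (zeroTest m)) ![
      .unitary (.q₂ V),
      .seq (.unitary (.q₁ (shiftDown m))) <|
      .seq (.call .qSearch) <|
      .seq (.unitary (.q₂ Rt)) <|
      .seq (.call .qSearchDag) <|
      .seq (.unitary (.q₂ Rs)) <|
      .seq (.call .qSearch) <|
      .unitary (.q₁ (shiftUp m))]
  | .qSearchDag => .branch (.q₁ (zeroTest m)) ![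
      .unitary (.q₂ (star V)),
      .seq (.unitary (.q₁ (shiftDown m))) <|
      .seq (.call .qSearchDag) <|
      .seq (.unitary (.q₂ (star Rs))) <|
      .seq (.call .qSearch) <|
      .seq (.unitary (.q₂ (star Rt))) <|
      .seq (.call .qSearchDag) <|
      .unitary (.q₁ (shiftUp m))]

/-- What the procedures implement at depth `n`: `Vₙ` and `Vₙ†`. -/
def implemented {N : ℕ} (V Rs Rt : Matrix.unitaryGroup (Fin N) ℂ) (p : Proc) (n : ℕ) :
    Matrix.unitaryGroup (Fin N) ℂ :=
  match p with
  | .qSearch => engine V Rs Rt n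
  | .qSearchDag => star (engine V Rs Rt n)

/-- The Kraus operators `|i⟩⟨i| ⊗ Wᵢ†` for `i < j`. -/
def controlledOp {d N : ℕ} (j : ℕ) (W : ℕ → Matrix.unitaryGroup (Fin N) ℂ) (i : Fin d) : Op d N :=
  if (i : ℕ) < j then Matrix.single i i 1 ⊗ₖ (W i).1.conjTranspose else 0

theorem controlledOp_bound {d N : ℕ} (j : ℕ) (W : ℕ → Matrix.unitaryGroup (Fin N) ℂ) :
    Loewner (∑ i : Fin d, (controlledOp j W i).conjTranspose * controlledOp j W i) 1 := by
  have key : ∀ i : Fin d, (controlledOp j W i).conjTranspose * controlledOp j W i =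
      Matrix.diagonal fun x : Joint d N => if x.1 = i ∧ (i : ℕ) < j then (1 : ℂ) else 0 := by
    intro i
    by_cases hi : (i : ℕ) < j
    · have hW : (W i).1 * (W i).1.conjTranspose = 1 := by
        rw [← Matrix.star_eq_conjTranspose]
        exact Matrix.mem_unitaryGroup_iff.mp (W i).2
      simp only [controlledOp, hi, if_true, Matrix.conjTranspose_kronecker,
        ← Matrix.mul_kronecker_mul, Matrix.conjTranspose_conjTranspose, hW]
      ext ⟨a, b⟩ ⟨a', b'⟩
      simp only [Matrix.conjTranspose_single, Matrix.single_mul_single_same, Matrix.kronecker_apply,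
        Matrix.diagonal_apply, Matrix.single_apply, Matrix.one_apply, Prod.mk.injEq]
      rcases eq_or_ne i a with rfl | h1
      · rcases eq_or_ne i a' with rfl | h2
        · simp
        · simp [h2]
      · simp [h1, Ne.symm h1]
    · simp [controlledOp, hi, ← Matrix.diagonal_zero]
  have hs : (1 : Op d N) - ∑ i : Fin d, (controlledOp j W i).conjTranspose * controlledOp j W i =
      Matrix.diagonal fun x : Joint d N => if (x.1 : ℕ) < j then (0 : ℂ) else 1 := by
    simp only [key]
    ext x y
    by_cases h : x = y
    · subst h
      by_cases hx : (x.1 : ℕ) < j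
      · rw [Matrix.sub_apply, Matrix.sum_apply, Finset.sum_eq_single x.1] <;> simp_all
        intro b hb hbx; exact absurd hbx.symm hb
      · rw [Matrix.sub_apply, Matrix.sum_apply, Finset.sum_eq_zero] <;> simp_all
    · simp [h, Matrix.sum_apply]
  rw [Loewner, hs, Matrix.posSemidef_diagonal_iff]
  intro x
  split_ifs <;> simp

/-- The quantum operation with the Kraus operators `controlledOp j W`. -/
def controlledQOp {d N : ℕ} (j : ℕ) (W : ℕ → Matrix.unitaryGroup (Fin N) ℂ) :
    QOp (Joint d N) where
  size := d
  kraus := controlledOp j W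
  bound := controlledOp_bound j W

/-- The assertion `ℰ*(B)`. -/
def Term.ofQOp {β σ : Type} [Fintype σ] [DecidableEq σ] (B : β) (E : QOp σ) : Term β σ where
  base := B
  E := E
  F := .zero σ
  bound := by
    have h : (QOp.zero σ).dual 1 = 0 := by
      unfold QOp.dual
      exact Finset.sum_eq_zero fun k _ => by simp [QOp.zero]
    rw [h, add_zero]
    simpa [QOp.dual] using E.bound

/-- The assertion `∑_{i < j} (|i⟩⟨i| ⊗ Wᵢ) B (|i⟩⟨i| ⊗ Wᵢ†)` over the base `B`; for `B = A ⊗ B'`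
it is `∑_{i < j} A_{i,i} |i⟩⟨i| ⊗ Wᵢ B' Wᵢ†`. -/
def controlled {d N : ℕ} (B : Base) (j : ℕ) (W : ℕ → Matrix.unitaryGroup (Fin N) ℂ) :
    Assertion d N :=
  .ofQOp B (controlledQOp j W)

/-- The projection `|n⟩⟨n| ⊗ |ψ⟩⟨ψ|`. -/
def ketProj {d N : ℕ} (n : Fin d) (ψ : EuclideanSpace ℂ (Fin N)) : Op d N :=
  Matrix.single n n 1 ⊗ₖ outer ψ ψ

theorem ketProj_bound {d N : ℕ} (n : Fin d) (ψ : EuclideanSpace ℂ (Fin N)) (h : ‖ψ‖ = 1) :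
    Loewner ((ketProj n ψ).conjTranspose * ketProj n ψ) 1 := by
  have hH : (ketProj n ψ).conjTranspose = ketProj n ψ := by
    simp [ketProj, Matrix.conjTranspose_kronecker, outer_conjTranspose,
      Matrix.conjTranspose_single]
  have hP : ketProj n ψ * ketProj n ψ = ketProj n ψ := by
    rw [ketProj, ← Matrix.mul_kronecker_mul, outer_mul_outer ψ h]
    simp
  rw [hH, hP, Loewner]
  have : (1 : Op d N) - ketProj n ψ =
      (1 - ketProj n ψ).conjTranspose * (1 - ketProj n ψ) := by
    simp [Matrix.conjTranspose_sub, hH, mul_sub, sub_mul, hP]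
  rw [this]
  exact Matrix.posSemidef_conjTranspose_mul_self _

/-- The assertion without parameters that denotes `|n⟩⟨n| ⊗ |ψ⟩⟨ψ|`, for a unit vector `ψ`. -/
def ketAssertion {d N : ℕ} (n : Fin d) (ψ : EuclideanSpace ℂ (Fin N)) (h : ‖ψ‖ = 1) :
    Assertion d N :=
  .ofQOp (.tensor none none)
    { size := 1
      kraus := fun _ => ketProj n ψ
      bound := by simpa using ketProj_bound n ψ h }

/-- `U|ψ⟩`. -/
def applyU {N : ℕ} (U : Matrix.unitaryGroup (Fin N) ℂ) (ψ : EuclideanSpace ℂ (Fin N)) :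
    EuclideanSpace ℂ (Fin N) :=
  WithLp.toLp 2 (U.1.mulVec ψ)

theorem norm_applyU {N : ℕ} (U : Matrix.unitaryGroup (Fin N) ℂ) (ψ : EuclideanSpace ℂ (Fin N))
    (h : ‖ψ‖ = 1) : ‖applyU U ψ‖ = 1 := by
  have h1 : ∀ φ : EuclideanSpace ℂ (Fin N), ((‖φ‖ : ℂ)) ^ 2 = star (φ : Fin N → ℂ) ⬝ᵥ φ := by
    intro φ
    have h2 := EuclideanSpace.inner_eq_star_dotProduct φ φ
    rw [inner_self_eq_norm_sq_to_K] at h2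
    rw [dotProduct_comm]
    simpa using h2
  have h3 : ((‖applyU U ψ‖ : ℂ)) ^ 2 = (‖ψ‖ : ℂ) ^ 2 := by
    rw [h1, h1]
    simp only [applyU]
    rw [Matrix.star_mulVec, Matrix.dotProduct_mulVec, Matrix.vecMul_vecMul,
      ← Matrix.star_eq_conjTranspose, Matrix.mem_unitaryGroup_iff'.mp U.2, Matrix.vecMul_one]
  rw [h] at h3
  have h4 : ‖applyU U ψ‖ ^ 2 = 1 := by
    have h5 : ((‖applyU U ψ‖ ^ 2 : ℝ) : ℂ) = ((1 : ℝ) : ℂ) := by simpa using h3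
    exact_mod_cast h5
  nlinarith [norm_nonneg (applyU U ψ)]

end QHoare

end

noncomputable section

namespace QHoare

/-! ### Block-diagonal operators -/

/-! Everything reduces to blocks indexed by the value of the counter `q₁`. The recursive branch is
entered only when the counter is nonzero, so decrementing it never wraps around and the final
increment restores it. If calls act on block `n` as conjugation by `Wₙ`, the recursive branch acts
on block `n + 1` as conjugation by `Wₙ S₂ W'ₙ S₁ Wₙ`, where `W'` belongs to the other procedure.
This product is `Wₙ₊₁` for both procedures, because taking adjoints in `Vₙ R_s Vₙ† R_t Vₙ` turns one
body into the other (`implemented_succ`).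

Semantics: the `k`-th syntactic approximation treats blocks `i < k` correctly and leaves the value
of `⊥` in the others (`preWith_approx_search`, `semWith_approx_search`). There are only `2 ^ m`
counter values, so the approximations are constant from `k = 2 ^ m` on and the limits are exact. The
resulting weakest precondition equals the claimed precondition, in both modes.

Proofs in the calculus: the assertions used have blocks `Uᵢ B_{g i} Uᵢ†` on a set of counter values.
This class is stable under the steps of the bodies: a unitary on `q₂` changes `U`, a shift of `q₁`
reindexes the blocks, and a call multiplies `Uᵢ` by `Wᵢ`. The call step needs a hypothesis about a
single variable `X` on the pair, into which any assertion may be substituted; a variable on each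
register would not suffice, since the intermediate assertions are not tensor products. One passage
through a body extends the precondition from counters below `j` to counters below `j + 1`
(`baseProvable_body`), which is the premise of the total rule, and of the partial rule at `j = 2 ^
m`. All other provable triples are substitution instances of the one for `X`. -/

/-- The block-diagonal operator `∑ᵢ |i⟩⟨i| ⊗ Bᵢ`. -/
def blocks {d N : ℕ} (B : Fin d → Matrix (Fin N) (Fin N) ℂ) : Op d N :=
  Matrix.of fun x y => if x.1 = y.1 then B x.1 x.2 y.2 else 0

/-- The diagonal block `⟨i| A |i⟩`. -/
def block {d N : ℕ} (A : Op d N) (i : Fin d) : Matrix (Fin N) (Fin N) ℂ :=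
  A.submatrix (Prod.mk i) (Prod.mk i)

section Blocks

variable {d N : ℕ}

@[simp]
theorem block_blocks (B : Fin d → Matrix (Fin N) (Fin N) ℂ) (i : Fin d) :
    block (blocks B) i = B i := by
  ext a b; simp [block, blocks]

theorem blocks_zero : blocks (fun _ : Fin d => (0 : Matrix (Fin N) (Fin N) ℂ)) = 0 := by
  ext x y; simp [blocks]

theorem blocks_one : blocks (fun _ : Fin d => (1 : Matrix (Fin N) (Fin N) ℂ)) = 1 := by
  ext ⟨a, b⟩ ⟨a', b'⟩
  by_cases h : a = a' <;> simp [blocks, Matrix.one_apply, h]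

theorem blocks_add (B C : Fin d → Matrix (Fin N) (Fin N) ℂ) :
    blocks B + blocks C = blocks (fun i => B i + C i) := by
  ext x y
  by_cases h : x.1 = y.1 <;> simp [blocks, h]

theorem single_kronecker (i : Fin d) (B : Matrix (Fin N) (Fin N) ℂ) :
    Matrix.single i i (1 : ℂ) ⊗ₖ B = blocks (fun k => if k = i then B else 0) := by
  ext ⟨a, b⟩ ⟨a', b'⟩
  simp only [blocks, Matrix.kronecker_apply, Matrix.single_apply, Matrix.of_apply]
  by_cases h : a = a'
  · subst h
    by_cases h' : i = a <;> simp [h', eq_comm]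
  · have : ¬(i = a ∧ i = a') := fun h' => h (h'.1.symm.trans h'.2)
    simp [h, this]

theorem sum_single_kronecker (B : Fin d → Matrix (Fin N) (Fin N) ℂ) :
    ∑ i, Matrix.single i i (1 : ℂ) ⊗ₖ B i = blocks B := by
  ext x y
  simp only [single_kronecker, Matrix.sum_apply, blocks, Matrix.of_apply]
  by_cases h : x.1 = y.1
  · simp only [h, if_true]
    rw [Finset.sum_eq_single y.1] <;> simp
    intro b hb
    simp [Ne.symm hb]
  · simp [h]

theorem blocks_conjTranspose (B : Fin d → Matrix (Fin N) (Fin N) ℂ) :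
    (blocks B).conjTranspose = blocks (fun i => (B i).conjTranspose) := by
  ext x y
  by_cases h : x.1 = y.1
  · simp [blocks, Matrix.conjTranspose_apply, h]
  · simp [blocks, Matrix.conjTranspose_apply, h, Ne.symm h]

theorem blocks_mul_apply (B : Fin d → Matrix (Fin N) (Fin N) ℂ) (A : Op d N) (x y : Joint d N) :
    (blocks B * A) x y = ∑ k, B x.1 x.2 k * A (x.1, k) y := by
  simp [blocks, Matrix.mul_apply, Fintype.sum_prod_type, ite_mul]

theorem mul_blocks_apply (B : Fin d → Matrix (Fin N) (Fin N) ℂ) (A : Op d N) (x y : Joint d N) :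
    (A * blocks B) x y = ∑ k, A x (y.1, k) * B y.1 k y.2 := by
  simp only [blocks, Matrix.mul_apply, Fintype.sum_prod_type, Matrix.of_apply, mul_ite, mul_zero]
  rw [Finset.sum_comm]
  simp

theorem blocks_mul_blocks (B C : Fin d → Matrix (Fin N) (Fin N) ℂ) :
    blocks B * blocks C = blocks (fun i => B i * C i) := by
  ext x y
  rw [blocks_mul_apply]
  by_cases h : x.1 = y.1 <;> simp [blocks, Matrix.mul_apply, h]

/-- Block-diagonal factors do not mix blocks, so the off-diagonal part of an arbitrary `A` never has
to be tracked. -/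
theorem block_blocks_mul_mul (B C : Fin d → Matrix (Fin N) (Fin N) ℂ) (A : Op d N) (i : Fin d) :
    block (blocks B * A * blocks C) i = B i * block A i * C i := by
  ext a b
  rw [block, Matrix.submatrix_apply, mul_blocks_apply]
  simp only [blocks_mul_apply]
  simp only [Matrix.mul_apply, block, Matrix.submatrix_apply]

theorem lift_q₂_eq_blocks (U : Matrix (Fin N) (Fin N) ℂ) :
    (lift (.q₂ U) : Op d N) = blocks (fun _ => U) := by
  ext ⟨a, b⟩ ⟨a', b'⟩
  by_cases h : a = a' <;> simp [lift, blocks, h]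

theorem lift_q₁_diagonal (δ : Fin d → ℂ) :
    (lift (.q₁ (Matrix.diagonal δ)) : Op d N) = blocks (fun i => δ i • 1) := by
  ext ⟨a, b⟩ ⟨a', b'⟩
  by_cases h : a = a' <;> simp [lift, blocks, h]

theorem mul_single_kronecker_apply (a b : Fin d) (M : Matrix (Fin N) (Fin N) ℂ) (A : Op d N)
    (x y : Joint d N) :
    (A * (Matrix.single a b (1 : ℂ) ⊗ₖ M)) x y =
      if b = y.1 then ∑ k, A x (a, k) * M k y.2 else 0 := by
  rw [Matrix.mul_apply, Fintype.sum_prod_type, Finset.sum_eq_single a]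
  · by_cases h : b = y.1 <;> simp [h]
  · intro i _ hi
    simp [hi.symm]
  · simp

/-- The factor `|a⟩⟨b|` has rank one: it reads off block `a` and writes it at position `b`,
discarding all coherences of the first register. -/
theorem single_kronecker_conj (a b : Fin d) (M : Matrix (Fin N) (Fin N) ℂ) (A : Op d N) :
    (Matrix.single a b (1 : ℂ) ⊗ₖ M).conjTranspose * A * (Matrix.single a b (1 : ℂ) ⊗ₖ M) =
      Matrix.single b b (1 : ℂ) ⊗ₖ (M.conjTranspose * block A a * M) := by
  have key : ∀ x y, ((Matrix.single a b (1 : ℂ) ⊗ₖ M).conjTranspose * A) x y =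
      if b = x.1 then ∑ k, star (M k x.2) * A (a, k) y else 0 := by
    intro x y
    have h := congrArg star (mul_single_kronecker_apply a b M A.conjTranspose y x)
    rw [← Matrix.conjTranspose_apply, Matrix.conjTranspose_mul,
      Matrix.conjTranspose_conjTranspose] at h
    rw [h]
    split_ifs <;> simp [star_sum, Matrix.conjTranspose_apply, mul_comm]
  ext x y
  rw [mul_single_kronecker_apply]
  simp only [key]
  by_cases h : b = x.1 <;> by_cases h' : b = y.1 <;>
    simp [h, h', Matrix.mul_apply, block]
  all_goals simp_all

theorem permUnitary_conj (f : Equiv.Perm (Fin d)) (A : Op d N) :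
    (lift (.q₁ (permUnitary f).1) : Op d N).conjTranspose * A * lift (.q₁ (permUnitary f).1) =
      A.submatrix (Prod.map f id) (Prod.map f id) := by
  ext ⟨i, k⟩ ⟨i', k'⟩
  simp only [Matrix.mul_apply, Fintype.sum_prod_type, Matrix.conjTranspose_apply, lift,
    Matrix.kronecker_apply, permUnitary, Matrix.of_apply, Matrix.one_apply, Matrix.submatrix_apply]
  simp [ite_mul, apply_ite]

theorem lift_q₁_permUnitary_conjTranspose (f : Equiv.Perm (Fin d)) :
    (lift (.q₁ (permUnitary f).1) : Op d N).conjTranspose =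
      lift (.q₁ (permUnitary f.symm).1) := by
  have h : (permUnitary f).1.conjTranspose = (permUnitary f.symm).1 := by
    ext i j
    simp only [permUnitary, Matrix.conjTranspose_apply, Matrix.of_apply, Equiv.eq_symm_apply]
    simp [apply_ite, eq_comm]
  simp [lift, Matrix.conjTranspose_kronecker, h]

theorem permUnitary_conj' (f : Equiv.Perm (Fin d)) (A : Op d N) :
    (lift (.q₁ (permUnitary f).1) : Op d N) * A * (lift (.q₁ (permUnitary f).1)).conjTranspose =
      A.submatrix (Prod.map f.symm id) (Prod.map f.symm id) := by
  rw [← permUnitary_conj, lift_q₁_permUnitary_conjTranspose, lift_q₁_permUnitary_conjTranspose,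
    Equiv.symm_symm]

theorem block_submatrix (f : Fin d → Fin d) (A : Op d N) (i : Fin d) :
    block (A.submatrix (Prod.map f id) (Prod.map f id)) i = block A (f i) := rfl

theorem blocks_submatrix (f : Equiv.Perm (Fin d)) (B : Fin d → Matrix (Fin N) (Fin N) ℂ) :
    (blocks B).submatrix (Prod.map f id) (Prod.map f id) = blocks (fun i => B (f i)) := by
  ext x y
  simp [blocks]

end Blocks

/-! ### Semantics of the approximations -/

section Replace

variable {d₁ d₂ : ℕ} [NeZero d₁] [NeZero d₂] {Name : Type}

/-- The transformer is compositional, so replacing calls by statements amounts to reinterpreting the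
calls. This turns the syntactic approximations into iterates of the body's transformer. -/
theorem preWith_replace (c : Mode) (ω : Name → Op d₁ d₂ → Op d₁ d₂)
    (T : Name → Stmt d₁ d₂ Name) (S : Stmt d₁ d₂ Name) (A : Op d₁ d₂) :
    preWith c ω (S.replace T) A = preWith c (fun p => preWith c ω (T p)) S A := by
  induction S generalizing A with
  | seq S₁ S₂ h₁ h₂ => simp [Stmt.replace, preWith, h₁, h₂]
  | branch M S h => simp [Stmt.replace, preWith, h]
  | _ => rfl

theorem semWith_replace (ω : Name → Op d₁ d₂ → Op d₁ d₂)
    (T : Name → Stmt d₁ d₂ Name) (S : Stmt d₁ d₂ Name) (ρ : Op d₁ d₂) :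
    semWith ω (S.replace T) ρ = semWith (fun p => semWith ω (T p)) S ρ := by
  induction S generalizing ρ with
  | seq S₁ S₂ h₁ h₂ => simp [Stmt.replace, semWith, h₁, h₂]
  | branch M S h => simp [Stmt.replace, semWith, h]
  | _ => rfl

theorem preWith_approx_succ (c : Mode) (D : Decl d₁ d₂ Name) (k : ℕ) (p : Name) (A : Op d₁ d₂) :
    preWith c (fun _ _ => 0) (approx D (k + 1) p) A =
      preWith c (fun p' => preWith c (fun _ _ => 0) (approx D k p')) (D p) A := by
  rw [approx, preWith_replace]
  rfl

theorem semWith_approx_succ (D : Decl d₁ d₂ Name) (k : ℕ) (p : Name) (ρ : Op d₁ d₂) :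
    semWith (fun _ _ => 0) (approx D (k + 1) p) ρ =
      semWith (fun p' => semWith (fun _ _ => 0) (approx D k p')) (D p) ρ := by
  rw [approx, semWith_replace]
  rfl

end Replace

theorem limit_eq_of_eventually_const {σ : Type} {A : ℕ → Matrix σ σ ℂ} {B : Matrix σ σ ℂ} (n : ℕ)
    (h : ∀ k, n ≤ k → A k = B) : limit A = B :=
  (tendsto_const_nhds.congr' (Filter.eventually_atTop.2 ⟨n, fun k hk => (h k hk).symm⟩)).limUnder_eq

/-! ### The bodies of the two procedures -/

/-- The procedure that runs backwards. -/
def Proc.dag : Proc → Proc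
  | .qSearch => .qSearchDag
  | .qSearchDag => .qSearch

section Search

variable {m N : ℕ} (V Rs Rt : Matrix.unitaryGroup (Fin N) ℂ)

/-- The unitary applied after the first recursive call. -/
def firstShift (Rs Rt : Matrix.unitaryGroup (Fin N) ℂ) : Proc → Matrix.unitaryGroup (Fin N) ℂ
  | .qSearch => Rt
  | .qSearchDag => star Rs

/-- The unitary applied after the second recursive call. -/
def secondShift (Rs Rt : Matrix.unitaryGroup (Fin N) ℂ) : Proc → Matrix.unitaryGroup (Fin N) ℂ
  | .qSearch => Rs
  | .qSearchDag => star Rt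

/-- The recursive branch of the body of `p`. -/
def recBranch (m : ℕ) (Rs Rt : Matrix.unitaryGroup (Fin N) ℂ) (p : Proc) : Stmt (2 ^ m) N Proc :=
  .seq (.unitary (.q₁ (shiftDown m))) <|
  .seq (.call p) <|
  .seq (.unitary (.q₂ (firstShift Rs Rt p))) <|
  .seq (.call p.dag) <|
  .seq (.unitary (.q₂ (secondShift Rs Rt p))) <|
  .seq (.call p) <|
  .unitary (.q₁ (shiftUp m))

theorem searchDecl_eq (p : Proc) : searchDecl m V Rs Rt p =
    .branch (.q₁ (zeroTest m))
      ![.unitary (.q₂ (implemented V Rs Rt p 0)), recBranch m Rs Rt p] := by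
  cases p <;> rfl

/-- The adjoint of `Vₙ R_s Vₙ† R_t Vₙ` is `Vₙ† R_t† Vₙ R_s† Vₙ†`: the same pattern with the
procedures exchanged and other phase shifts. One argument therefore covers both bodies. -/
theorem implemented_succ (p : Proc) (n : ℕ) : implemented V Rs Rt p (n + 1) =
    implemented V Rs Rt p n * (secondShift Rs Rt p * (implemented V Rs Rt p.dag n *
      (firstShift Rs Rt p * implemented V Rs Rt p n))) := by
  cases p <;> simp [implemented, engine, secondShift, firstShift, Proc.dag, mul_assoc]

theorem val_sub_one_add_one {d : ℕ} [NeZero d] {i : Fin d} (h : i ≠ 0) :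
    ((i - 1 : Fin d) : ℕ) + 1 = i := by
  rw [Fin.val_sub_one_of_ne_zero h]
  exact Nat.sub_add_cancel (Nat.pos_of_ne_zero fun h' => h (Fin.ext (by simp [h'])))

theorem zeroTest_zero : LocalMeas.toOp (.q₁ (zeroTest m) : LocalMeas (2 ^ m) N 2) 0 =
    Matrix.single 0 0 1 ⊗ₖ 1 := by
  have : (lift (.q₁ (Matrix.diagonal fun i => if i = 0 then 1 else 0)) : Op (2 ^ m) N) =
      Matrix.single 0 0 1 ⊗ₖ 1 := by
    rw [lift_q₁_diagonal, single_kronecker]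
    simp [ite_smul]
  exact this

theorem zeroTest_one : LocalMeas.toOp (.q₁ (zeroTest m) : LocalMeas (2 ^ m) N 2) 1 =
    blocks (fun i => if i = 0 then 0 else 1) := by
  have : (lift (.q₁ (Matrix.diagonal fun i => if i = 0 then 0 else 1)) : Op (2 ^ m) N) =
      blocks (fun i => if i = 0 then 0 else 1) := by
    rw [lift_q₁_diagonal]
    simp [ite_smul]
  exact this

/-- Outcome 0 projects onto one counter value, so the result is block diagonal for every `A`.
Outcome 1 keeps coherences between nonzero values, but preconditions of the recursive branch are
already block diagonal. -/
theorem zeroTest_zero_conj (A : Op (2 ^ m) N) :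
    (LocalMeas.toOp (.q₁ (zeroTest m) : LocalMeas (2 ^ m) N 2) 0).conjTranspose * A *
      LocalMeas.toOp (.q₁ (zeroTest m) : LocalMeas (2 ^ m) N 2) 0 =
      blocks (fun i => if i = 0 then block A i else 0) := by
  rw [zeroTest_zero, single_kronecker_conj, single_kronecker]
  congr! 2 with i
  split_ifs with h <;> simp [h]

theorem zeroTest_conjTranspose (i : Fin 2) :
    (LocalMeas.toOp (.q₁ (zeroTest m) : LocalMeas (2 ^ m) N 2) i).conjTranspose =
      LocalMeas.toOp (.q₁ (zeroTest m) : LocalMeas (2 ^ m) N 2) i := by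
  fin_cases i
  · simp [zeroTest_zero, Matrix.conjTranspose_kronecker, Matrix.conjTranspose_single]
  · simp [zeroTest_one, blocks_conjTranspose, apply_ite]

theorem zeroTest_one_conj (B : Fin (2 ^ m) → Matrix (Fin N) (Fin N) ℂ) :
    (LocalMeas.toOp (.q₁ (zeroTest m) : LocalMeas (2 ^ m) N 2) 1).conjTranspose * blocks B *
      LocalMeas.toOp (.q₁ (zeroTest m) : LocalMeas (2 ^ m) N 2) 1 =
      blocks (fun i => if i = 0 then 0 else B i) := by
  simp only [zeroTest_one, blocks_conjTranspose, blocks_mul_blocks]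
  congr! 2 with i
  split_ifs with h <;> simp

theorem shiftUp_conj (A : Op (2 ^ m) N) :
    (LocalUnitary.toOp (.q₁ (shiftUp m))).conjTranspose * A * LocalUnitary.toOp (.q₁ (shiftUp m)) =
      A.submatrix (Prod.map (· + 1) id) (Prod.map (· + 1) id) :=
  permUnitary_conj _ A

theorem shiftUp_conj' (A : Op (2 ^ m) N) :
    LocalUnitary.toOp (.q₁ (shiftUp m)) * A * (LocalUnitary.toOp (.q₁ (shiftUp m))).conjTranspose =
      A.submatrix (Prod.map (· - 1) id) (Prod.map (· - 1) id) := by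
  have h : ⇑(Equiv.addRight (1 : Fin (2 ^ m))).symm = (· - 1) :=
    funext fun i => (sub_eq_add_neg i 1).symm
  rw [← h]
  exact permUnitary_conj' _ A

theorem shiftDown_conj (A : Op (2 ^ m) N) :
    (LocalUnitary.toOp (.q₁ (shiftDown m))).conjTranspose * A *
      LocalUnitary.toOp (.q₁ (shiftDown m)) =
      A.submatrix (Prod.map (· - 1) id) (Prod.map (· - 1) id) :=
  permUnitary_conj _ A

theorem shiftDown_conj' (A : Op (2 ^ m) N) :
    LocalUnitary.toOp (.q₁ (shiftDown m)) * A *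
      (LocalUnitary.toOp (.q₁ (shiftDown m))).conjTranspose =
      A.submatrix (Prod.map (· + 1) id) (Prod.map (· + 1) id) :=
  permUnitary_conj' _ A

theorem block_unitary_conj (U : Matrix.unitaryGroup (Fin N) ℂ) {d : ℕ} (A : Op d N) (i : Fin d) :
    block ((LocalUnitary.toOp (.q₂ U)).conjTranspose * A * LocalUnitary.toOp (.q₂ U)) i =
      U.1.conjTranspose * block A i * U.1 := by
  simp only [LocalUnitary.toOp, lift_q₂_eq_blocks, blocks_conjTranspose, block_blocks_mul_mul]

/-! ### Semantics of the search procedures -/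

variable [NeZero N]

/-- A counter `i ≠ 0` reaches the calls as `i - 1`, which moves the cutoff from `k` to `k + 1`.
Beyond the cutoff the first call alone yields `b`, whatever its postcondition, so one statement with
arbitrary `b` serves both modes. -/
theorem preWith_search (c : Mode) (k : ℕ) (b : Matrix (Fin N) (Fin N) ℂ) (p : Proc)
    (ω : Proc → Op (2 ^ m) N → Op (2 ^ m) N)
    (hω : ∀ p A, ω p A = blocks (fun i => if (i : ℕ) < k then
      (implemented V Rs Rt p i).1.conjTranspose * block A i * (implemented V Rs Rt p i).1 else b))
    (A : Op (2 ^ m) N) :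
    preWith c ω (searchDecl m V Rs Rt p) A = blocks (fun i => if (i : ℕ) < k + 1 then
      (implemented V Rs Rt p i).1.conjTranspose * block A i * (implemented V Rs Rt p i).1
      else b) := by
  rw [searchDecl_eq]
  simp only [preWith, Fin.sum_univ_two, Matrix.cons_val_zero, Matrix.cons_val_one,
    zeroTest_zero_conj, recBranch, hω, shiftDown_conj, shiftUp_conj]
  have hs : ∀ B : Fin (2 ^ m) → Matrix (Fin N) (Fin N) ℂ,
      (blocks B).submatrix (Prod.map (· - 1) id) (Prod.map (· - 1) id) =
        blocks (fun i => B (i - 1)) := blocks_submatrix (Equiv.subRight 1)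
  rw [hs, zeroTest_one_conj, blocks_add]
  congr! 2 with i
  simp only [block_unitary_conj, block_blocks]
  by_cases h : i = 0
  · subst h
    simp
  · have hi := val_sub_one_add_one h
    simp only [h, if_false, zero_add, block_submatrix, sub_add_cancel]
    rw [← hi, implemented_succ]
    by_cases hk : ((i - 1 : Fin (2 ^ m)) : ℕ) < k
    · simp [hk, Matrix.conjTranspose_mul, mul_assoc]
    · simp [hk]

theorem preWith_approx_search (c : Mode) (b : Matrix (Fin N) (Fin N) ℂ)
    (hb : (c.botPre : Op (2 ^ m) N) = blocks (fun _ => b)) (k : ℕ) (p : Proc)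
    (A : Op (2 ^ m) N) :
    preWith c (fun _ _ => 0) (approx (searchDecl m V Rs Rt) k p) A =
      blocks (fun i => if (i : ℕ) < k then
        (implemented V Rs Rt p i).1.conjTranspose * block A i * (implemented V Rs Rt p i).1
        else b) := by
  induction k generalizing p A with
  | zero => simpa [approx, preWith] using hb
  | succ k ih => rw [preWith_approx_succ, preWith_search V Rs Rt c k b p _ ih]

theorem weakestPre_search (c : Mode) (p : Proc) (A : Op (2 ^ m) N) :
    weakestPre c (searchDecl m V Rs Rt) (.call p) A = blocks (fun i =>
      (implemented V Rs Rt p i).1.conjTranspose * block A i * (implemented V Rs Rt p i).1) := by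
  obtain ⟨b, hb⟩ : ∃ b, (c.botPre : Op (2 ^ m) N) = blocks (fun _ => b) := by
    cases c
    · exact ⟨1, blocks_one.symm⟩
    · exact ⟨0, blocks_zero.symm⟩
  -- From `k = 2 ^ m` on, every counter value lies below the cutoff and the default block `b` no
  -- longer occurs.
  refine limit_eq_of_eventually_const (2 ^ m) fun k hk => ?_
  rw [preWith_approx_search V Rs Rt c b hb]
  congr! 2 with i
  rw [if_pos (i.2.trans_le hk)]

theorem semWith_search (k : ℕ) (p : Proc)
    (ω : Proc → Op (2 ^ m) N → Op (2 ^ m) N)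
    (hω : ∀ p A, ω p A = blocks (fun i => if (i : ℕ) < k then
      (implemented V Rs Rt p i).1 * block A i * (implemented V Rs Rt p i).1.conjTranspose else 0))
    (A : Op (2 ^ m) N) :
    semWith ω (searchDecl m V Rs Rt p) A = blocks (fun i => if (i : ℕ) < k + 1 then
      (implemented V Rs Rt p i).1 * block A i * (implemented V Rs Rt p i).1.conjTranspose
      else 0) := by
  rw [searchDecl_eq]
  have h0 := zeroTest_zero_conj A
  rw [zeroTest_conjTranspose] at h0
  -- Forwards, the measurement meets an arbitrary `A`, so outcome 1 need not be block diagonal; the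
  -- first call then reads only its diagonal blocks.
  have h1 : LocalMeas.toOp (.q₁ (zeroTest m) : LocalMeas (2 ^ m) N 2) 1 * A *
      (LocalMeas.toOp (.q₁ (zeroTest m) : LocalMeas (2 ^ m) N 2) 1).conjTranspose =
      blocks (fun i => if i = 0 then 0 else 1) * A * blocks (fun i => if i = 0 then 0 else 1) := by
    rw [zeroTest_conjTranspose, zeroTest_one]
  have hs : ∀ B : Fin (2 ^ m) → Matrix (Fin N) (Fin N) ℂ,
      (blocks B).submatrix (Prod.map (· - 1) id) (Prod.map (· - 1) id) =
        blocks (fun i => B (i - 1)) := blocks_submatrix (Equiv.subRight 1)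
  have hu : ∀ (U : Matrix.unitaryGroup (Fin N) ℂ) (B : Fin (2 ^ m) → Matrix (Fin N) (Fin N) ℂ),
      LocalUnitary.toOp (.q₂ U) * blocks B * (LocalUnitary.toOp (.q₂ U)).conjTranspose =
        blocks (fun i => U.1 * B i * U.1.conjTranspose) := by
    intro U B
    simp only [LocalUnitary.toOp, lift_q₂_eq_blocks, blocks_conjTranspose, blocks_mul_blocks]
  simp only [semWith, Fin.sum_univ_two, Matrix.cons_val_zero, Matrix.cons_val_one, recBranch, hω,
    shiftDown_conj', shiftUp_conj', hs, hu, block_blocks]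
  rw [zeroTest_conjTranspose, h0, hu, h1, blocks_add]
  congr! 2 with i
  by_cases h : i = 0
  · subst h
    simp [block_submatrix, block_blocks_mul_mul]
  · have hi := val_sub_one_add_one h
    simp only [h, if_false, mul_zero, zero_mul, zero_add, block_submatrix, sub_add_cancel,
      block_blocks_mul_mul, one_mul, mul_one]
    rw [← hi, implemented_succ]
    by_cases hk : ((i - 1 : Fin (2 ^ m)) : ℕ) < k
    · simp [hk, Matrix.conjTranspose_mul, mul_assoc]
    · simp [hk]

theorem semWith_approx_search (k : ℕ) (p : Proc) (A : Op (2 ^ m) N) :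
    semWith (fun _ _ => 0) (approx (searchDecl m V Rs Rt) k p) A =
      blocks (fun i => if (i : ℕ) < k then
        (implemented V Rs Rt p i).1 * block A i * (implemented V Rs Rt p i).1.conjTranspose
        else 0) := by
  induction k generalizing p A with
  | zero => simp [approx, semWith, blocks_zero]
  | succ k ih => rw [semWith_approx_succ, semWith_search V Rs Rt k p _ ih]

theorem sem_search (p : Proc) (A : Op (2 ^ m) N) :
    sem (searchDecl m V Rs Rt) (.call p) A = blocks (fun i =>
      (implemented V Rs Rt p i).1 * block A i * (implemented V Rs Rt p i).1.conjTranspose) := by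
  refine limit_eq_of_eventually_const (2 ^ m) fun k hk => ?_
  rw [semWith_approx_search]
  congr! 2 with i
  rw [if_pos (i.2.trans_le hk)]

end Search

/-! ### Block-diagonal assertions -/

section Assertions

variable {d N : ℕ}

theorem loewner_blocks_one (c : Fin d → Prop) [DecidablePred c] :
    Loewner (blocks fun i => if c i then 1 else 0) (1 : Op d N) := by
  have : (1 : Op d N) - blocks (fun i => if c i then 1 else 0) =
      Matrix.diagonal fun x => if c x.1 then 0 else 1 := by
    ext ⟨a, b⟩ ⟨a', b'⟩
    by_cases h : a = a' <;> by_cases h' : b = b' <;> by_cases hc : c a' <;>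
      simp [blocks, h, h', hc]
  rw [Loewner, this, Matrix.posSemidef_diagonal_iff]
  intro x
  split_ifs <;> simp

theorem unitary_mul_conjTranspose (U : Matrix.unitaryGroup (Fin N) ℂ) :
    U.1 * U.1.conjTranspose = 1 :=
  Matrix.mem_unitaryGroup_iff.mp U.2

theorem unitary_conjTranspose_mul (U : Matrix.unitaryGroup (Fin N) ℂ) :
    U.1.conjTranspose * U.1 = 1 :=
  Matrix.mem_unitaryGroup_iff'.mp U.2

theorem unitary_conj_cancel (U : Matrix.unitaryGroup (Fin N) ℂ) (A : Matrix (Fin N) (Fin N) ℂ) :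
    U.1.conjTranspose * (U.1 * A * U.1.conjTranspose) * U.1 = A := by
  calc _ = (U.1.conjTranspose * U.1) * A * (U.1.conjTranspose * U.1) := by simp only [mul_assoc]
    _ = A := by rw [unitary_conjTranspose_mul, one_mul, mul_one]

open Classical in
/-- The Kraus operators `|g i⟩⟨i| ⊗ Uᵢ†` for `i` with `c i`. -/
def blockOp (c : Fin d → Prop) (g : Fin d → Fin d) (U : Fin d → Matrix.unitaryGroup (Fin N) ℂ)
    (i : Fin d) : Op d N :=
  if c i then Matrix.single (g i) i 1 ⊗ₖ (U i).1.conjTranspose else 0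

open Classical in
theorem sum_blockOp_conj (c : Fin d → Prop) (g : Fin d → Fin d)
    (U : Fin d → Matrix.unitaryGroup (Fin N) ℂ) (A : Op d N) :
    ∑ i, (blockOp c g U i).conjTranspose * A * blockOp c g U i = blocks fun i =>
      if c i then (U i).1 * block A (g i) * (U i).1.conjTranspose else 0 := by
  rw [← sum_single_kronecker]
  refine Finset.sum_congr rfl fun i _ => ?_
  by_cases h : c i <;> simp [blockOp, h, single_kronecker_conj]

theorem block_one (i : Fin d) : block (1 : Op d N) i = 1 := by
  rw [← blocks_one, block_blocks]

/-- The quantum operation with the Kraus operators `blockOp c g U`. -/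
def blockQOp (c : Fin d → Prop) (g : Fin d → Fin d) (U : Fin d → Matrix.unitaryGroup (Fin N) ℂ) :
    QOp (Joint d N) where
  size := d
  kraus := blockOp c g U
  bound := by
    classical
    have h := sum_blockOp_conj c g U 1
    simp only [mul_one, block_one, unitary_mul_conjTranspose] at h
    rw [h]
    convert loewner_blocks_one c

/-- The assertion that has the block `Uᵢ B_{g i} Uᵢ†` at each `i` with `c i`. -/
def blockAssertion (B : Base) (c : Fin d → Prop) (g : Fin d → Fin d)
    (U : Fin d → Matrix.unitaryGroup (Fin N) ℂ) : Assertion d N :=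
  .ofQOp B (blockQOp c g U)

theorem blockAssertion_congr (B : Base) {c c' : Fin d → Prop} {g g' : Fin d → Fin d}
    {U U' : Fin d → Matrix.unitaryGroup (Fin N) ℂ} (hc : ∀ i, c i ↔ c' i)
    (hg : ∀ i, c i → g i = g' i) (hU : ∀ i, c i → U i = U' i) :
    blockAssertion B c g U = blockAssertion B c' g' U' := by
  have h : blockOp c g U = blockOp c' g' U' := by
    funext i
    by_cases h : c i
    · simp [blockOp, h, ← hc, hg i h, hU i h]
    · simp [blockOp, h, ← hc]
  simp only [blockAssertion, blockQOp, h]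

theorem den_ofQOp (B : Base) (E : QOp (Joint d N)) (v : Assignment d N) :
    den (.ofQOp B E) v = E.dual (B.den v) := by
  have h : (QOp.zero (Joint d N)).dual 1 = 0 := by
    unfold QOp.dual
    exact Finset.sum_eq_zero fun k _ => by simp [QOp.zero]
  simp [den, Term.denWith, Term.ofQOp, h]

open Classical in
theorem den_blockAssertion (B : Base) (c : Fin d → Prop) (g : Fin d → Fin d)
    (U : Fin d → Matrix.unitaryGroup (Fin N) ℂ) (v : Assignment d N) :
    den (blockAssertion B c g U) v = blocks fun i =>
      if c i then (U i).1 * block (B.den v) (g i) * (U i).1.conjTranspose else 0 := by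
  rw [blockAssertion, den_ofQOp]
  exact sum_blockOp_conj c g U _

theorem dual_controlledQOp (j : ℕ) (W : ℕ → Matrix.unitaryGroup (Fin N) ℂ) (A : Op d N) :
    (controlledQOp j W).dual A = blocks fun i =>
      if (i : ℕ) < j then (W i).1 * block A i * (W i).1.conjTranspose else 0 := by
  rw [← sum_single_kronecker]
  refine Finset.sum_congr rfl fun (i : Fin d) _ => ?_
  have h' := single_kronecker_conj i i (W i).1.conjTranspose A
  rw [Matrix.conjTranspose_conjTranspose] at h'
  by_cases h : (i : ℕ) < j
  · simpa [controlledQOp, controlledOp, h] using h'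
  · simp [controlledQOp, controlledOp, h]

theorem controlled_eq_blockAssertion (B : Base) (j : ℕ) (W : ℕ → Matrix.unitaryGroup (Fin N) ℂ) :
    (controlled B j W : Assertion d N) =
      blockAssertion B (fun i => (i : ℕ) < j) id (fun i => W i) := by
  have : (controlledOp j W : Fin d → Op d N) =
      blockOp (fun i => (i : ℕ) < j) id (fun i => W i) := by
    funext i
    simp [controlledOp, blockOp]
  simp only [controlled, blockAssertion, controlledQOp, blockQOp, this]

theorem den_controlled (B : Base) (j : ℕ) (W : ℕ → Matrix.unitaryGroup (Fin N) ℂ)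
    (v : Assignment d N) :
    den (controlled B j W) v = blocks fun i =>
      if (i : ℕ) < j then (W i).1 * block (B.den v) i * (W i).1.conjTranspose else 0 := by
  rw [controlled, den_ofQOp, dual_controlledQOp]

theorem controlledQOp_le_succ (d j : ℕ) (W : ℕ → Matrix.unitaryGroup (Fin N) ℂ) :
    (controlledQOp j W : QOp (Joint d N)).le (controlledQOp (j + 1) W) := by
  -- The two operations differ only in the Kraus operator at `i = j`, which is absent when `j ≥ d`.
  refine ⟨blockQOp (fun i => (i : ℕ) = j) id (fun i => W i), fun ρ => ?_⟩
  refine Eq.trans (Finset.sum_congr rfl fun (i : Fin d) _ => ?_) Finset.sum_add_distrib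
  simp only [controlledQOp, blockQOp, controlledOp, blockOp]
  rcases lt_trichotomy (i : ℕ) j with h | h | h
  · simp [h, h.ne, Nat.lt_succ_of_lt h]
  · simp [h]
  · simp [h.ne', h.not_gt, Nat.not_lt.2 (Nat.succ_le_of_lt h)]

theorem Loewner.refl {σ : Type} (A : Matrix σ σ ℂ) : Loewner A A := by
  simpa [Loewner] using Matrix.PosSemidef.zero

theorem Below.of_den_eq {P Q : Assertion d N} (hp : params P = params Q)
    (h : ∀ v, den P v = den Q v) : Below P Q :=
  ⟨hp, fun v _ => by rw [h]; exact .refl _⟩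

theorem QOp.dual_posSemidef (E : QOp (Joint d N)) {A : Op d N} (hA : A.PosSemidef) :
    (E.dual A).PosSemidef :=
  Matrix.posSemidef_sum _ fun k _ => hA.conjTranspose_mul_mul_same (E.kraus k)

/-- The difference is the same operation restricted to `b ∧ ¬ a`, applied to a positive operator;
this uses that predicate variables range over positive operators. -/
theorem blockAssertion_below (x : ℕ) {a b : Fin d → Prop} (hab : ∀ i, a i → b i)
    (g : Fin d → Fin d) (K : Fin d → Matrix.unitaryGroup (Fin N) ℂ) :
    Below (blockAssertion (.var x) a g K) (blockAssertion (.var x) b g K) := by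
  classical
  refine ⟨rfl, fun v hv => ?_⟩
  have hX : (Base.den v (.var x)).PosSemidef := by
    have h := (hv.2.2 x).1
    rwa [Loewner, sub_zero] at h
  have hd : den (blockAssertion (.var x) b g K) v =
      den (blockAssertion (.var x) a g K) v +
        den (blockAssertion (.var x) (fun i => b i ∧ ¬ a i) g K) v := by
    simp only [den_blockAssertion, blocks_add]
    congr! 2 with i
    by_cases ha : a i
    · simp [ha, hab i ha]
    · simp [ha]
  rw [Loewner, hd, add_sub_cancel_left, blockAssertion, den_ofQOp]
  exact QOp.dual_posSemidef _ hX

/-- The substitution of `T` for the variable numbered `0` on `q₁, q₂`. -/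
def substPair (T : Assertion d N) : Substitution d N where
  -- The single-register variables get an arbitrary term, here `0`; they do not occur where the
  -- substitution is applied.
  t₁ _ := .ofQOp none (.zero _)
  t₂ _ := .ofQOp none (.zero _)
  t₁₂ _ := T

/-- An assertion over one variable on the pair has a single parameter, so the side condition of the
substitution rule holds for every `T`. -/
theorem isSubst_substPair (T P' : Assertion d N) (E : QOp (Joint d N))
    (hp : params P' = params T) (h : ∀ v, den P' v = E.dual (den T v)) :
    IsSubst (substPair T) (.ofQOp (.var 0) E) P' := by
  refine ⟨Or.inl ?_, ?_, fun v _ => ?_⟩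
  · exact Set.subsingleton_singleton
  · rw [hp]
    ext Y
    simp [params, Base.params, Term.ofQOp, Substitution.params, substPair]
  · rw [h, den_ofQOp]
    rfl

end Assertions

/-! ### Derivations in the proof systems -/

section Proofs

variable {m N : ℕ} [NeZero N] (V Rs Rt : Matrix.unitaryGroup (Fin N) ℂ) (c : Mode)
  (Γ : Set (Triple (2 ^ m) N Proc))

theorem BaseProvable.unitary_q₂ (B : Base) (U : Matrix.unitaryGroup (Fin N) ℂ)
    (a : Fin (2 ^ m) → Prop) (g : Fin (2 ^ m) → Fin (2 ^ m))
    (K : Fin (2 ^ m) → Matrix.unitaryGroup (Fin N) ℂ) :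
    BaseProvable c Γ ⟨blockAssertion B a g K, .unitary (.q₂ U),
      blockAssertion B a g (fun i => U * K i)⟩ := by
  classical
  refine .unitary _ _ _ ⟨rfl, fun v _ => ?_⟩
  simp only [den_blockAssertion, LocalUnitary.toOp, lift_q₂_eq_blocks, blocks_conjTranspose,
    blocks_mul_blocks]
  congr! 2 with i
  split_ifs
  · simp only [Submonoid.coe_mul, Matrix.conjTranspose_mul]
    -- The outer factors `1` are inserted to be rewritten as `U† U`.
    calc _ = 1 * ((K i).1 * block (Base.den v B) (g i) * (K i).1.conjTranspose) * 1 := by simp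
      _ = _ := by
        rw [← unitary_conjTranspose_mul U]
        simp only [mul_assoc]
  · simp

theorem BaseProvable.unitary_q₁ (B : Base) (f : Equiv.Perm (Fin (2 ^ m)))
    (a : Fin (2 ^ m) → Prop) (g : Fin (2 ^ m) → Fin (2 ^ m))
    (K : Fin (2 ^ m) → Matrix.unitaryGroup (Fin N) ℂ) :
    BaseProvable c Γ ⟨blockAssertion B (a ∘ f) (g ∘ f) (K ∘ f), .unitary (.q₁ (permUnitary f)),
      blockAssertion B a g K⟩ := by
  classical
  refine .unitary _ _ _ ⟨rfl, fun v _ => ?_⟩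
  simp only [den_blockAssertion, LocalUnitary.toOp, permUnitary_conj, blocks_submatrix]
  rfl

variable {Γ} in
-- Substituting the block assertion for `X` gives the triple: the cutoff at `j` removes nothing, as
-- the support `a` lies below `j`. With `Γ` arbitrary, this serves both inside the recursion rules
-- and for their conclusions.
theorem BaseProvable.call_block {j : ℕ} {p : Proc} {W : ℕ → Matrix.unitaryGroup (Fin N) ℂ}
    (h : BaseProvable c Γ ⟨controlled (.var 0) j (fun _ => 1), .call p,
      controlled (.var 0) (2 ^ m) W⟩) (B : Base)
    (a : Fin (2 ^ m) → Prop) (ha : ∀ i, a i → (i : ℕ) < j) (g : Fin (2 ^ m) → Fin (2 ^ m))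
    (K : Fin (2 ^ m) → Matrix.unitaryGroup (Fin N) ℂ) :
    BaseProvable c Γ ⟨blockAssertion B a g K, .call p,
      blockAssertion B a g (fun i => W i * K i)⟩ := by
  classical
  refine .subst (substPair (blockAssertion B a g K)) _ _ _ _ _ h ?_ ?_
  · refine isSubst_substPair _ _ _ rfl fun v => ?_
    simp only [dual_controlledQOp, den_blockAssertion, block_blocks]
    congr! 2 with i
    by_cases h : a i <;> simp [h, ha]
  · refine isSubst_substPair _ _ _ rfl fun v => ?_
    simp only [dual_controlledQOp, den_blockAssertion, block_blocks]
    congr! 2 with i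
    by_cases h : a i <;> simp [h, Matrix.conjTranspose_mul, mul_assoc]

theorem baseProvable_recBranch (B : Base) (j : ℕ)
    (h : ∀ p, BaseProvable c Γ ⟨controlled (.var 0) j (fun _ => 1), .call p,
      controlled (.var 0) (2 ^ m) (implemented V Rs Rt p)⟩) (p : Proc) :
    BaseProvable c Γ ⟨blockAssertion B (fun i => i ≠ 0 ∧ (i : ℕ) < j + 1) id (fun _ => 1),
      recBranch m Rs Rt p,
      blockAssertion B (fun i => i ≠ 0 ∧ (i : ℕ) < j + 1) id (fun i => implemented V Rs Rt p i)⟩ := by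
  -- Support after the decrement: `i + 1` is the original counter, so `i + 1 ≠ 0` excludes the last
  -- value, where the increment would wrap. The reindexing `(· + 1)` below records which block of
  -- the base now sits at `i`.
  let a : Fin (2 ^ m) → Prop := fun i => i + 1 ≠ 0 ∧ (i : ℕ) < j
  have ha : ∀ i, a i → (i : ℕ) < j := fun i hi => hi.2
  refine .comp _ _ _ (blockAssertion B a (· + 1) (fun _ => 1)) _ ?_ <|
    .comp _ _ _ _ _ (.call_block c (h p) B a ha _ _) <|
    .comp _ _ _ _ _ (.unitary_q₂ c Γ B _ a _ _) <|
    .comp _ _ _ _ _ (.call_block c (h p.dag) B a ha _ _) <|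
    .comp _ _ _ _ _ (.unitary_q₂ c Γ B _ a _ _) <|
    .comp _ _ _ _ _ (.call_block c (h p) B a ha _ _) ?_
  · convert BaseProvable.unitary_q₁ c Γ B (Equiv.subRight 1) a (· + 1) (fun _ => 1) using 2
    swap
    · rfl
    refine blockAssertion_congr B (fun i => ?_) (fun i _ => by simp) fun _ _ => rfl
    simp only [a, Function.comp, Equiv.subRight_apply, sub_add_cancel]
    refine and_congr_right fun hi => ?_
    rw [← val_sub_one_add_one hi, Nat.add_lt_add_iff_right]
  · have hv : ∀ i : Fin (2 ^ m), i + 1 ≠ 0 → ((i + 1 : Fin (2 ^ m)) : ℕ) = i + 1 := fun i hi => by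
      rw [← val_sub_one_add_one hi, add_sub_cancel_right]
    convert BaseProvable.unitary_q₁ c Γ B (Equiv.addRight 1)
      (fun i => i ≠ 0 ∧ (i : ℕ) < j + 1) id (fun i => implemented V Rs Rt p i) using 2
    swap
    · rfl
    refine blockAssertion_congr B (fun i => ?_) (fun i _ => by simp) fun i hi => ?_
    · simp only [a, Function.comp, Equiv.coe_addRight]
      refine and_congr_right fun hi => ?_
      rw [hv i hi, Nat.add_lt_add_iff_right]
    · simp only [Function.comp, Equiv.coe_addRight]
      rw [hv i hi.1, implemented_succ, mul_one]

/-- Outcome 0 covers the block at counter 0 without any call, and outcome 1 covers the nonzero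
counters up to `j` using calls below `j`. Each branch ends with only part of the postcondition,
which the order rule enlarges. -/
theorem baseProvable_body (j : ℕ)
    (h : ∀ p, BaseProvable c Γ ⟨controlled (.var 0) j (fun _ => 1), .call p,
      controlled (.var 0) (2 ^ m) (implemented V Rs Rt p)⟩) (p : Proc) :
    BaseProvable c Γ ⟨controlled (.var 0) (j + 1) (fun _ => 1), searchDecl m V Rs Rt p,
      controlled (.var 0) (2 ^ m) (implemented V Rs Rt p)⟩ := by
  classical
  have hpost : ∀ a : Fin (2 ^ m) → Prop,
      Below (blockAssertion (.var 0) a id (fun i => implemented V Rs Rt p i))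
        (controlled (.var 0) (2 ^ m) (implemented V Rs Rt p)) := fun a => by
    rw [controlled_eq_blockAssertion]
    exact blockAssertion_below 0 (fun i _ => i.2) _ _
  have hrefl : ∀ P : Assertion (2 ^ m) N, Below P P := fun P => .of_den_eq rfl fun _ => rfl
  rw [searchDecl_eq]
  refine .branch _ _ ![blockAssertion (.var 0) (fun i => i = 0) id (fun _ => 1),
    blockAssertion (.var 0) (fun i => i ≠ 0 ∧ (i : ℕ) < j + 1) id (fun _ => 1)] _ _
    (Fin.forall_fin_two.2 ⟨?_, ?_⟩) (Fin.forall_fin_two.2 ⟨rfl, rfl⟩) fun v _ => ?_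
  · refine .order _ _ _ _ _ (hrefl _) (.unitary_q₂ c Γ _ _ _ _ _) ?_
    -- The support is `i = 0`, so the constant family `W₀` may be replaced by `Wᵢ`.
    rw [blockAssertion_congr (U' := fun i => implemented V Rs Rt p i) _ (fun _ => Iff.rfl)
      (fun _ _ => rfl) fun i hi => by simp [hi]]
    exact hpost _
  · exact .order _ _ _ _ _ (hrefl _) (baseProvable_recBranch V Rs Rt c Γ _ j h p) (hpost _)
  · simp only [Fin.sum_univ_two, Matrix.cons_val_zero, Matrix.cons_val_one, zeroTest_zero_conj,
      den_blockAssertion, zeroTest_one_conj, blocks_add, den_controlled, block_blocks]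
    congr! 2 with i
    by_cases hi : i = 0 <;> simp [hi]

theorem baseProvable_body_of_callTriples (j : ℕ) (p : Proc) :
    BaseProvable c (callTriples (fun _ => controlled (.var 0) j (fun _ => 1))
        (fun p => controlled (.var 0) (2 ^ m) (implemented V Rs Rt p)))
      ⟨controlled (.var 0) (j + 1) (fun _ => 1), searchDecl m V Rs Rt p,
        controlled (.var 0) (2 ^ m) (implemented V Rs Rt p)⟩ := by
  refine baseProvable_body V Rs Rt c _ j (fun p' => .hyp _ ?_) p
  exact ⟨p', rfl⟩

theorem totalRecPremise_search : TotalRecPremise (searchDecl m V Rs Rt)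
    (fun j _ => controlled (.var 0) j (fun _ => 1))
    (fun _ => controlled (.var 0) (2 ^ m) (fun _ => 1))
    (fun p => controlled (.var 0) (2 ^ m) (implemented V Rs Rt p)) := by
  refine ⟨fun p => ⟨controlled (.var 0) (2 ^ m) (fun _ => 1), fun n => controlledQOp n (fun _ => 1),
    fun n => controlledQOp_le_succ _ n _, fun n => ⟨rfl, fun v _ => ?_⟩⟩, fun p v _ => ?_,
    fun _ _ => rfl, fun j p => ?_, fun _ => rfl, fun p v _ => ?_⟩
  · simp [den_controlled, dual_controlledQOp]
  · simp [den_controlled, blocks_zero]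
  · exact baseProvable_body_of_callTriples V Rs Rt .total j p
  · rw [limit_eq_of_eventually_const (2 ^ m) fun k hk => ?_]
    · exact .refl _
    · simp only [den_controlled]
      congr! 2 with i
      simp [i.2.trans_le hk]

theorem partialRecPremise_search : PartialRecPremise (searchDecl m V Rs Rt)
    (fun _ => controlled (.var 0) (2 ^ m) (fun _ => 1))
    (fun p => controlled (.var 0) (2 ^ m) (implemented V Rs Rt p)) := by
  refine ⟨fun _ => rfl, fun p => ?_⟩
  -- No counter value reaches `2 ^ m`, so the cutoffs `2 ^ m` and `2 ^ m + 1` give the same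
  -- denotation and the body preserves the invariant.
  refine .order _ _ (controlled (.var 0) (2 ^ m + 1) (fun _ => 1)) _ _ (.of_den_eq rfl fun v => ?_)
    (baseProvable_body_of_callTriples V Rs Rt .part (2 ^ m) p) (.of_den_eq rfl fun _ => rfl)
  simp only [den_controlled]
  congr! 2 with i
  simp [i.2.trans (Nat.lt_succ_self _)]

theorem provable_search (p : Proc) : Provable c (searchDecl m V Rs Rt)
    ⟨controlled (.var 0) (2 ^ m) (fun _ => 1), .call p,
      controlled (.var 0) (2 ^ m) (implemented V Rs Rt p)⟩ := by
  refine .hyp _ ⟨fun _ => controlled (.var 0) (2 ^ m) (fun _ => 1),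
    fun p => controlled (.var 0) (2 ^ m) (implemented V Rs Rt p), ⟨p, rfl⟩, ?_⟩
  cases c
  · exact partialRecPremise_search V Rs Rt
  · exact ⟨_, totalRecPremise_search V Rs Rt⟩

theorem provable_controlled (B : Base) (p : Proc) : Provable c (searchDecl m V Rs Rt)
    ⟨controlled B (2 ^ m) (fun _ => 1), .call p,
      controlled B (2 ^ m) (implemented V Rs Rt p)⟩ := by
  simpa only [Provable, controlled_eq_blockAssertion, mul_one] using
    BaseProvable.call_block c (provable_search V Rs Rt c p) B (fun i => (i : ℕ) < 2 ^ m)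
      (fun _ h => h) id (fun _ => 1)

theorem correct_of_den_eq {p : Proc} {P Q : Assertion (2 ^ m) N} (hp : params P = params Q)
    (h : ∀ v, den P v = blocks fun i => (implemented V Rs Rt p i).1.conjTranspose *
      block (den Q v) i * (implemented V Rs Rt p i).1) :
    Correct c (searchDecl m V Rs Rt) ⟨P, .call p, Q⟩ := by
  refine ⟨hp, fun v _ => ?_⟩
  rw [weakestPre_search, h]
  exact .refl _

theorem correct_controlled (B : Base) (p : Proc) : Correct c (searchDecl m V Rs Rt)
    ⟨controlled B (2 ^ m) (fun _ => 1), .call p,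
      controlled B (2 ^ m) (implemented V Rs Rt p)⟩ := by
  refine correct_of_den_eq V Rs Rt c rfl fun v => ?_
  simp only [den_controlled, block_blocks]
  congr! 2 with i
  rw [if_pos i.2, if_pos i.2, unitary_conj_cancel]
  simp

end Proofs

/-! ### Projections onto pure states -/

section Kets

variable {d N : ℕ}

theorem outer_applyU (U : Matrix.unitaryGroup (Fin N) ℂ) (ψ : EuclideanSpace ℂ (Fin N)) :
    (outer (applyU U ψ) (applyU U ψ) : Matrix (Fin N) (Fin N) ℂ) =
      U.1 * (outer ψ ψ : Matrix (Fin N) (Fin N) ℂ) * U.1.conjTranspose := by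
  simp only [outer, applyU, Matrix.mul_vecMulVec, Matrix.vecMulVec_mul, Matrix.star_mulVec]

theorem ketProj_eq_blocks (n : Fin d) (ψ : EuclideanSpace ℂ (Fin N)) :
    ketProj n ψ = blocks fun i => if i = n then (outer ψ ψ : Matrix (Fin N) (Fin N) ℂ) else 0 :=
  single_kronecker n _

theorem den_ketAssertion (n : Fin d) (ψ : EuclideanSpace ℂ (Fin N)) (h : ‖ψ‖ = 1)
    (v : Assignment d N) : den (ketAssertion n ψ h) v = ketProj n ψ := by
  rw [ketAssertion, den_ofQOp]
  have h1 : Base.den v (.tensor none none) = (1 : Op d N) := Matrix.one_kronecker_one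
  simp only [QOp.dual, h1, Finset.univ_unique, Finset.sum_singleton, mul_one]
  simp only [ketProj_eq_blocks, blocks_conjTranspose, blocks_mul_blocks]
  congr! 2 with i
  split_ifs
  · rw [outer_conjTranspose, outer_mul_outer ψ h]
  · simp

end Kets

end QHoare

end

/-! ### Main theorem -/

theorem mainTheorem12 (m N : ℕ) [NeZero N] (s t : EuclideanSpace ℂ (Fin N))
    (hs : ‖s‖ = 1) (ht : ‖t‖ = 1) (V : Matrix.unitaryGroup (Fin N) ℂ) :
    let Rs := QHoare.phaseShift s hs
    let Rt := QHoare.phaseShift t ht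
    let D := QHoare.searchDecl m V Rs Rt
    let W := QHoare.implemented V Rs Rt
    let AB : QHoare.Base := .tensor (some 0) (some 0)
    let X : QHoare.Base := .var 0
    -- correctness and provability on input `|n⟩ ⊗ |s⟩`, and the output state
    (∀ (p : QHoare.Proc) (n : Fin (2 ^ m)),
      (∀ c : QHoare.Mode,
        QHoare.Correct c D ⟨QHoare.ketAssertion n s hs, .call p,
          QHoare.ketAssertion n (QHoare.applyU (W p n) s) (QHoare.norm_applyU (W p n) s hs)⟩ ∧
        QHoare.Provable c D ⟨QHoare.ketAssertion n s hs, .call p,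
          QHoare.ketAssertion n (QHoare.applyU (W p n) s) (QHoare.norm_applyU (W p n) s hs)⟩) ∧
      QHoare.sem D (.call p) (QHoare.ketProj n s) =
        QHoare.ketProj n (QHoare.applyU (W p n) s)) ∧
    -- the parameterized triples with predicate variables `A` on `q₁` and `B` on `q₂`
    (∀ (p : QHoare.Proc) (c : QHoare.Mode),
      QHoare.Correct c D ⟨QHoare.controlled AB (2 ^ m) (fun _ => 1), .call p,
        QHoare.controlled AB (2 ^ m) (W p)⟩ ∧
      QHoare.Provable c D ⟨QHoare.controlled AB (2 ^ m) (fun _ => 1), .call p,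
        QHoare.controlled AB (2 ^ m) (W p)⟩) ∧
    -- the premises of the recursion rules, with a predicate variable `X` on `q₁, q₂`
    QHoare.TotalRecPremise D (fun j _ => QHoare.controlled X j (fun _ => 1))
      (fun _ => QHoare.controlled X (2 ^ m) (fun _ => 1))
      (fun p => QHoare.controlled X (2 ^ m) (W p)) ∧
    QHoare.PartialRecPremise D (fun _ => QHoare.controlled X (2 ^ m) (fun _ => 1))
      (fun p => QHoare.controlled X (2 ^ m) (W p)) := by
  intro Rs Rt D W AB X
  refine ⟨fun p n => ⟨fun c => ⟨?_, ?_⟩, ?_⟩, fun p c => ⟨?_, ?_⟩, ?_, ?_⟩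
  · refine QHoare.correct_of_den_eq V Rs Rt c rfl fun v => ?_
    simp only [QHoare.den_ketAssertion, QHoare.ketProj_eq_blocks, QHoare.block_blocks]
    congr! 2 with i
    split_ifs with h
    · rw [h, QHoare.outer_applyU, QHoare.unitary_conj_cancel]
    · simp
  -- The concrete triple is the instance `X := |n⟩⟨n| ⊗ |s⟩⟨s|` of the triple for `X`; only block
  -- `n` survives.
  · refine .subst (QHoare.substPair (QHoare.ketAssertion n s hs)) _ _ _ _ _
      (QHoare.provable_search V Rs Rt c p) ?_ ?_
    · refine QHoare.isSubst_substPair _ _ _ rfl fun v => ?_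
      simp only [QHoare.den_ketAssertion, QHoare.dual_controlledQOp, QHoare.ketProj_eq_blocks,
        QHoare.block_blocks]
      simp
    · refine QHoare.isSubst_substPair _ _ _ rfl fun v => ?_
      simp only [QHoare.den_ketAssertion, QHoare.dual_controlledQOp, QHoare.ketProj_eq_blocks,
        QHoare.block_blocks]
      congr! 2 with i
      rw [if_pos i.2]
      split_ifs with h
      · rw [h, QHoare.outer_applyU]
      · simp
  · rw [QHoare.sem_search]
    simp only [QHoare.ketProj_eq_blocks, QHoare.block_blocks]
    congr! 2 with i
    split_ifs with h
    · rw [h, QHoare.outer_applyU]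
    · simp
  · exact QHoare.correct_controlled V Rs Rt c AB p
  · exact QHoare.provable_controlled V Rs Rt c AB p
  · exact QHoare.totalRecPremise_search V Rs Rt
  · exact QHoare.partialRecPremise_search V Rs Rt
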